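/- **Theorem 3.6.** Let $m\ge 2$, let $(M^m,g)$ and $(N^{m+1},h)$ be smooth Riemannian manifolds with $M$ connected, and suppose that $\mathrm{Ric}^N=\lambda h$ for a constant $\lambda\in\mathbb{R}$. Let $\phi:(M^m,g)\to(N^{m+1},h)$ be a smooth isometric immersion which is totally umbilical, i.e. for every unit normal vector $\nu$ at a point the shape operator satisfies $A_\nu X=H_\nu X$ for all tangent vectors $X$, where $H_\nu=\frac1m\operatorname{trace}A_\nu$. Let $\tau(\phi)=\mathrm{Trace}_g\nabla d\phi$ be the tension field and $$\tau_2(\phi)=\mathrm{Trace}_g(\nabla^\phi\nabla^\phi-\nabla^\phi_{\nabla^M})\tau(\phi)-\mathrm{Trace}_gR^N(d\phi,\tau(\phi))d\phi$$ the bitension field, where $R^N(X,Y)Z=[\nabla^N_X,\nabla^N_Y]Z-\nabla^N_{[X,Y]}Z$. The hypersurface is called biharmonic if $\tau_2(\phi)=0$, and $f$-biharmonic if there is a smooth function $f:M\to(0,\infty)$ with $$f\,\tau_2(\phi)+(\Delta f)\,\tau(\phi)+2\nabla^\phi_{\mathrm{grad} f}\,\tau(\phi)=0 .$$ Then the hypersurface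 is $f$-biharmonic if and only if one of the following holds: - it is totally geodesic; - it is biharmonic, $\lambda\ge 0$, and there is a smooth unit normal vector field along $\phi$ with respect to which its mean curvature is constant, $H=\sqrt{\lambda/m}$ or $H=-\sqrt{\lambda/m}$. -/

import Mathlib

open scoped Manifold ContDiff

noncomputable section

namespace FBiharmonic

/-- A smooth Riemannian metric on a smooth manifold `M` of dimension `n`. -/
abbrev Metric (n : ℕ) (M : Type*) [TopologicalSpace M] [ChartedSpace (EuclideanSpace ℝ (Fin n)) M]
    [IsManifold (𝓡 n) ∞ M] :=
  Bundle.ContMDiffRiemannianMetric (𝓡 n) ∞ (EuclideanSpace ℝ (Fin n))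
    (fun p : M => TangentSpace (𝓡 n) p)

section OneManifold

variable {n : ℕ} {M : Type*} [TopologicalSpace M] [ChartedSpace (EuclideanSpace ℝ (Fin n)) M]

/-- The derivative at `p`, in the direction `v`, of a function on `M` with values in a fixed
normed space. -/
def dirDeriv {F : Type*} [NormedAddCommGroup F] [NormedSpace ℝ F] (f : M → F) (p : M)
    (v : TangentSpace (𝓡 n) p) : F :=
  mfderiv (𝓡 n) 𝓘(ℝ, F) f p v

/-- The coordinate basis of `T_pM` given by the preferred chart at `p`. -/
def coordBasis (p : M) (i : Fin n) : TangentSpace (𝓡 n) p :=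
  (EuclideanSpace.single i (1 : ℝ) : EuclideanSpace ℝ (Fin n))

variable [IsManifold (𝓡 n) ∞ M]

/-- The vector field which has value `v` at `p` and constant coefficients with respect to the
coordinate frame of the preferred chart at `p` (it is `0` outside the domain of that chart). -/
def coordField (p : M) (v : TangentSpace (𝓡 n) p) : Π q : M, TangentSpace (𝓡 n) q :=
  haveI : IsManifold (𝓡 n) 1 M := IsManifold.of_le (n := ∞) (by simp)
  fun q => (trivializationAt (EuclideanSpace ℝ (Fin n)) (TangentSpace (𝓡 n) : M → Type _) p).symmL
    ℝ q v

variable (g : Metric n M)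

/-- The matrix `(g_ij)` at `p` in the coordinate basis. -/
def gram (p : M) : Matrix (Fin n) (Fin n) ℝ :=
  Matrix.of fun i j => g.inner p (coordBasis p i) (coordBasis p j)

/-- The metric trace `∑ g^{ij} B(∂_i, ∂_j)` of a bilinear map on `T_pM`. -/
def metricTrace {W : Type*} [AddCommGroup W] [Module ℝ W] (p : M)
    (B : TangentSpace (𝓡 n) p → TangentSpace (𝓡 n) p → W) : W :=
  ∑ i, ∑ j, (gram g p)⁻¹ i j • B (coordBasis p i) (coordBasis p j)

/-- The tangent vector `∑ g^{ij} α(∂_j) ∂_i` dual to a linear form `α` on `T_pM`. -/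
def sharp (p : M) (α : TangentSpace (𝓡 n) p → ℝ) : TangentSpace (𝓡 n) p :=
  ∑ i, ∑ j, ((gram g p)⁻¹ i j * α (coordBasis p j)) • coordBasis p i

/-- The Christoffel symbol `Γ(v, w) = v^i w^j Γ_ij^k ∂_k` at `p` of the preferred chart at `p`:
`g(Γ(v, w), z) = (∂_v g(w, z) + ∂_w g(v, z) - ∂_z g(v, w)) / 2`. -/
def christoffel (p : M) (v w : TangentSpace (𝓡 n) p) : TangentSpace (𝓡 n) p :=
  sharp g p fun z => (1 / 2 : ℝ) *
    (dirDeriv (fun q => g.inner q (coordField p w q) (coordField p z q)) p v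
      + dirDeriv (fun q => g.inner q (coordField p v q) (coordField p z q)) p w
      - dirDeriv (fun q => g.inner q (coordField p v q) (coordField p w q)) p z)

/-- The gradient of a function. -/
def grad (f : M → ℝ) (p : M) : TangentSpace (𝓡 n) p :=
  sharp g p (dirDeriv f p)

end OneManifold

section Connection

variable {m n : ℕ}
  {M : Type*} [TopologicalSpace M] [ChartedSpace (EuclideanSpace ℝ (Fin m)) M]
  {N : Type*} [TopologicalSpace N] [ChartedSpace (EuclideanSpace ℝ (Fin n)) N]
  [IsManifold (𝓡 n) ∞ N]

/-- The differential of a map. -/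
def differential (φ : M → N) (p : M) (v : TangentSpace (𝓡 m) p) : TangentSpace (𝓡 n) (φ p) :=
  mfderiv (𝓡 m) (𝓡 n) φ p v

/-- The coefficients of a section `V` along `φ` in the coordinate frame of the preferred
chart of `N` at `φ p`. -/
def coeffAlong (φ : M → N) (V : Π q : M, TangentSpace (𝓡 n) (φ q)) (p : M) :
    M → EuclideanSpace ℝ (Fin n) :=
  haveI : IsManifold (𝓡 n) 1 N := IsManifold.of_le (n := ∞) (by simp)
  fun q => (trivializationAt (EuclideanSpace ℝ (Fin n)) (TangentSpace (𝓡 n) : N → Type _) (φ p)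
    (⟨φ q, V q⟩ : TangentBundle (𝓡 n) N)).2

/-- The vector `v(V^a) ∂_a` at `φ p`, where `V^a` are the coefficients of `V` in the coordinate
frame of the preferred chart at `φ p`. -/
def frameDeriv (φ : M → N) (V : Π q : M, TangentSpace (𝓡 n) (φ q)) (p : M)
    (v : TangentSpace (𝓡 m) p) : TangentSpace (𝓡 n) (φ p) :=
  dirDeriv (F := EuclideanSpace ℝ (Fin n)) (coeffAlong φ V p) p v

/-- The covariant derivative `∇^φ_v V` of a section `V` of `φ^* TN`, for the pull-back of the
Levi-Civita connection of `(N, h)`: in the chart at `φ p` it is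
`v(V^a) ∂_a + Γ(dφ(v), V)`. -/
def covAlong (h : Metric n N) (φ : M → N) (V : Π q : M, TangentSpace (𝓡 n) (φ q)) (p : M)
    (v : TangentSpace (𝓡 m) p) : TangentSpace (𝓡 n) (φ p) :=
  frameDeriv φ V p v + christoffel h (φ p) (differential φ p v) (V p)

/-- The Levi-Civita covariant derivative `∇_v Y` of a vector field. -/
def nabla (h : Metric n N) (Y : Π y : N, TangentSpace (𝓡 n) y) (y : N) (v : TangentSpace (𝓡 n) y) :
    TangentSpace (𝓡 n) y :=
  covAlong h (fun x : N => x) Y y v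

/-- The curvature operator `R(u, v) w = [∇_X, ∇_Y] Z - ∇_[X,Y] Z`, where `X, Y, Z` extend
`u, v, w`. -/
def curvature (h : Metric n N) (y : N) (u v w : TangentSpace (𝓡 n) y) : TangentSpace (𝓡 n) y :=
  nabla h (fun x => nabla h (coordField y w) x (coordField y v x)) y u
    - nabla h (fun x => nabla h (coordField y w) x (coordField y u x)) y v
    - nabla h (coordField y w) y
        (VectorField.mlieBracket (𝓡 n) (coordField y u) (coordField y v) y)

/-- The Ricci curvature `Ric(v, w) = trace (u ↦ R(u, v) w)`. -/
def ricci (h : Metric n N) (y : N) (v w : TangentSpace (𝓡 n) y) : ℝ :=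
  metricTrace h y fun u u' => h.inner y (curvature h y u v w) u'

/-- `(N, h)` is an Einstein space with `Ric = lam h`. -/
def IsEinstein (h : Metric n N) (lam : ℝ) : Prop :=
  ∀ (y : N) (v w : TangentSpace (𝓡 n) y), ricci h y v w = lam * h.inner y v w

/-- The Laplace operator on functions: the trace of the Hessian
`(u, v) ↦ u(Y f) - (∇_u Y) f`, where `Y` extends `v`. -/
def laplacian (h : Metric n N) (f : N → ℝ) (y : N) : ℝ :=
  metricTrace h y fun u v =>
    dirDeriv (fun x => dirDeriv f x (coordField y v x)) y u
      - dirDeriv f y (nabla h (coordField y v) y u)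

/-- `ν` is a unit vector normal to `dφ(T_pM)`. -/
def IsUnitNormal (h : Metric n N) (φ : M → N) (p : M) (ν : TangentSpace (𝓡 n) (φ p)) : Prop :=
  h.inner (φ p) ν ν = 1 ∧ ∀ v : TangentSpace (𝓡 m) p, h.inner (φ p) (differential φ p v) ν = 0

end Connection

section Maps

variable {m n : ℕ}
  {M : Type*} [TopologicalSpace M] [ChartedSpace (EuclideanSpace ℝ (Fin m)) M]
  [IsManifold (𝓡 m) ∞ M]
  {N : Type*} [TopologicalSpace N] [ChartedSpace (EuclideanSpace ℝ (Fin n)) N]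
  [IsManifold (𝓡 n) ∞ N]
  (g : Metric m M) (h : Metric n N) (φ : M → N)

/-- The second fundamental form `(∇dφ)(u, v) = ∇^φ_u (dφ Y) - dφ (∇_u Y)` of a map, where `Y`
extends `v`. -/
def secondFundamentalForm (p : M) (u v : TangentSpace (𝓡 m) p) : TangentSpace (𝓡 n) (φ p) :=
  covAlong h φ (fun q => differential φ q (coordField p v q)) p u
    - differential φ p (nabla g (coordField p v) p u)

/-- The tension field `τ(φ) = Trace_g ∇dφ`. -/
def tension (p : M) : TangentSpace (𝓡 n) (φ p) :=
  metricTrace g p (secondFundamentalForm g h φ p)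

/-- The second covariant derivative `(∇^φ∇^φ - ∇^φ_{∇^M}) V`, i.e.
`(u, v) ↦ ∇^φ_u ∇^φ_Y V - ∇^φ_{∇_u Y} V`, where `Y` extends `v`. -/
def secondCovDeriv (V : Π q : M, TangentSpace (𝓡 n) (φ q)) (p : M)
    (u v : TangentSpace (𝓡 m) p) : TangentSpace (𝓡 n) (φ p) :=
  covAlong h φ (fun q => covAlong h φ V q (coordField p v q)) p u
    - covAlong h φ V p (nabla g (coordField p v) p u)

/-- The bitension field
`τ₂(φ) = Trace_g (∇^φ∇^φ - ∇^φ_{∇^M}) τ(φ) - Trace_g R^N(dφ, τ(φ)) dφ`. -/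
def bitension (p : M) : TangentSpace (𝓡 n) (φ p) :=
  metricTrace g p (secondCovDeriv g h φ (tension g h φ) p)
    - metricTrace g p fun u v =>
        curvature h (φ p) (differential φ p u) (tension g h φ p) (differential φ p v)

/-- The `f`-bitension field `τ_{2,f}(φ) = f τ₂(φ) + (Δf) τ(φ) + 2 ∇^φ_{grad f} τ(φ)`. -/
def fBitension (f : M → ℝ) (p : M) : TangentSpace (𝓡 n) (φ p) :=
  f p • bitension g h φ p + laplacian g f p • tension g h φ p
    + (2 : ℝ) • covAlong h φ (tension g h φ) p (grad g f p)

/-- `φ` is a biharmonic map. -/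
def IsBiharmonic : Prop := ∀ p, bitension g h φ p = 0

/-- `φ` is an `f`-biharmonic map, for a given function `f`. -/
def IsFBiharmonicMap (f : M → ℝ) : Prop := ∀ p, fBitension g h φ f p = 0

/-- A submanifold `φ` is `f`-biharmonic if it is an `f`-biharmonic map for some smooth positive
function `f` on it. -/
def IsFBiharmonicSubmanifold : Prop :=
  ∃ f : M → ℝ, ContMDiff (𝓡 m) 𝓘(ℝ, ℝ) ∞ f ∧ (∀ p, 0 < f p) ∧ IsFBiharmonicMap g h φ f

/-- `φ` is a smooth isometric immersion: `g = φ^* h`. -/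
def IsIsometricImmersion : Prop :=
  ContMDiff (𝓡 m) (𝓡 n) ∞ φ ∧ ∀ (p : M) (u v : TangentSpace (𝓡 m) p),
    h.inner (φ p) (differential φ p u) (differential φ p v) = g.inner p u v

/-- The shape operator `A_ν` with respect to a normal vector `ν`:
`g(A_ν u, v) = h((∇dφ)(u, v), ν)`. -/
def shapeOperator (p : M) (ν : TangentSpace (𝓡 n) (φ p)) (u : TangentSpace (𝓡 m) p) :
    TangentSpace (𝓡 m) p :=
  sharp g p fun v => h.inner (φ p) (secondFundamentalForm g h φ p u v) ν

/-- The mean curvature `H = (1/m) Trace A_ν` of a hypersurface with respect to the unit normal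
vector `ν`. -/
def meanCurvature (p : M) (ν : TangentSpace (𝓡 n) (φ p)) : ℝ :=
  (1 / (m : ℝ)) * metricTrace g p fun u v => g.inner p (shapeOperator g h φ p ν u) v

/-- A hypersurface is totally umbilical if `A(X) = H X` for all tangent vectors `X`. -/
def IsTotallyUmbilical : Prop :=
  ∀ (p : M) (ν : TangentSpace (𝓡 n) (φ p)), IsUnitNormal (m := m) h φ p ν →
    ∀ u : TangentSpace (𝓡 m) p, shapeOperator g h φ p ν u = meanCurvature g h φ p ν • u

/-- `φ` is totally geodesic: its second fundamental form vanishes. -/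
def IsTotallyGeodesic : Prop :=
  ∀ (p : M) (u v : TangentSpace (𝓡 m) p), secondFundamentalForm g h φ p u v = 0

/-- The hypersurface has a smooth unit normal vector field `ξ` with respect to which its mean
curvature function is the constant `c`. -/
def HasConstantMeanCurvature (c : ℝ) : Prop :=
  ∃ ξ : Π p : M, TangentSpace (𝓡 n) (φ p),
    ContMDiff (𝓡 m) (𝓡 n).tangent ∞ (fun p => (⟨φ p, ξ p⟩ : TangentBundle (𝓡 n) N)) ∧
    (∀ p, IsUnitNormal (m := m) h φ p (ξ p)) ∧ ∀ p, meanCurvature g h φ p (ξ p) = c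

end Maps

end FBiharmonic

/-!
Write `H` for the mean curvature vector `τ / m`. On an umbilical hypersurface the second fundamental
form is `g ⊗ H`, so wherever `H` does not vanish the unit normal `ν = H / |H|` satisfies
`∇ν = -|H| dφ`. Comparing the curvature of the pull-back connection, applied to `ν`, with the
Einstein condition gives `(m - 1) d|H| = 0`. Hence `d|H|²` vanishes where `H ≠ 0`, and it also
vanishes at the zeros of `H`, which are minima of `|H|²`; so `|H|` is constant.

If `H = 0`, the hypersurface is totally geodesic. Otherwise `∇τ = -m |H|² dφ`, which yields
`τ₂ = (λ - m |H|²) τ`. In the `f`-biharmonic equation the tangential part is then a multiple of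
`dφ (grad f)`, so `f` is constant, and the normal part says `λ = m |H|²`.

Covariant derivatives are defined at each point in the chart centred there; that they may be
computed in any other chart follows from metric compatibility, by testing against coordinate fields.
-/

noncomputable section

namespace FBiharmonic

set_option maxSynthPendingDepth 3

open Filter
open scoped Topology

/-! ### Connections in a chart -/

section Euclidean

variable {E F G H : Type*} [NormedAddCommGroup E] [NormedSpace ℝ E]
  [NormedAddCommGroup F] [NormedSpace ℝ F] [NormedAddCommGroup G] [NormedSpace ℝ G]
  [NormedAddCommGroup H] [NormedSpace ℝ H]

theorem fderiv_clm_apply₂ {B : E → F →L[ℝ] G →L[ℝ] H} {v : E → F} {w : E → G} {x : E}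
    (hB : DifferentiableAt ℝ B x) (hv : DifferentiableAt ℝ v x) (hw : DifferentiableAt ℝ w x)
    (u : E) : fderiv ℝ (fun z => B z (v z) (w z)) x u =
      fderiv ℝ B x u (v x) (w x) + B x (fderiv ℝ v x u) (w x) + B x (v x) (fderiv ℝ w x u) := by
  rw [((hB.hasFDerivAt.clm_apply hv.hasFDerivAt).clm_apply hw.hasFDerivAt).fderiv]
  simp
  abel

theorem fderiv_clm_apply_const {B : E → F →L[ℝ] G} {x : E} (hB : DifferentiableAt ℝ B x) (b : F)
    (u : E) : fderiv ℝ (fun z => B z b) x u = fderiv ℝ B x u b := by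
  simp [fderiv_clm_apply hB (differentiableAt_const b)]

theorem fderiv_clm_apply₂_const {B : E → F →L[ℝ] G →L[ℝ] H} {x : E} (hB : DifferentiableAt ℝ B x)
    (b : F) (c : G) (u : E) : fderiv ℝ (fun z => B z b c) x u = fderiv ℝ B x u b c := by
  simp [fderiv_clm_apply₂ hB (differentiableAt_const b) (differentiableAt_const c)]

/-- The form `(∂_a β(b, c) + ∂_b β(a, c) - ∂_c β(a, b)) / 2` of a field `β` of bilinear forms, the
right-hand side of Koszul's formula for constant vector fields. -/
def koszulForm (β : E → E →L[ℝ] E →L[ℝ] ℝ) (x : E) : E →L[ℝ] E →L[ℝ] E →L[ℝ] ℝ :=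
  (1 / 2 : ℝ) • (fderiv ℝ β x + (fderiv ℝ β x).flip -
    ((ContinuousLinearMap.flipₗᵢ ℝ E E ℝ).toContinuousLinearEquiv.toContinuousLinearMap).comp
      (fderiv ℝ β x).flip)

/-- The Christoffel symbols of a field `β` of symmetric nondegenerate bilinear forms: the
Koszul form with its last index raised. Where `β x` is not invertible the value is `0`. -/
def christoffelForm (β : E → E →L[ℝ] E →L[ℝ] ℝ) (x : E) : E →L[ℝ] E →L[ℝ] E :=
  (ContinuousLinearMap.compL ℝ E (E →L[ℝ] ℝ) E (β x).inverse).comp (koszulForm β x)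

/-- The curvature `R(a, b) c` of the connection `d + Γ` on the trivial bundle with fibre `F`. -/
def curvatureForm (Γ : E → E →L[ℝ] F →L[ℝ] F) (x a b : E) (c : F) : F :=
  fderiv ℝ Γ x a b c - fderiv ℝ Γ x b a c + Γ x a (Γ x b c) - Γ x b (Γ x a c)

/-- The covariant derivative `u ↦ ∇_u ν` of a section `ν` along `ψ`, for the pull-back under `ψ` of
the connection `d + Γ` on the trivial bundle with fibre `G`. -/
def covDerivForm (Γ : F → F →L[ℝ] G →L[ℝ] G) (ψ : E → F) (ν : E → G) (x : E) : E →L[ℝ] G :=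
  fderiv ℝ ν x + ((Γ (ψ x)).flip (ν x)).comp (fderiv ℝ ψ x)

section Christoffel

variable {β : E → E →L[ℝ] E →L[ℝ] ℝ} {x : E}

theorem koszulForm_apply (a b c : E) : koszulForm β x a b c =
    (1 / 2 : ℝ) * (fderiv ℝ β x a b c + fderiv ℝ β x b a c - fderiv ℝ β x c a b) := rfl

theorem apply_christoffelForm (hβ : (β x).IsInvertible) (a b c : E) :
    β x (christoffelForm β x a b) c = koszulForm β x a b c :=
  congrArg (fun L : E →L[ℝ] ℝ => L c) (hβ.self_apply_inverse (koszulForm β x a b))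

theorem fderiv_symm_of_symm (hd : DifferentiableAt ℝ β x) (hs : ∀ x a b, β x a b = β x b a)
    (a b c : E) : fderiv ℝ β x a b c = fderiv ℝ β x a c b := by
  simp only [← fderiv_clm_apply₂_const hd, hs _ b c]

theorem fderiv_eq_christoffelForm (hd : DifferentiableAt ℝ β x) (hs : ∀ x a b, β x a b = β x b a)
    (hβ : (β x).IsInvertible) (a b c : E) :
    fderiv ℝ β x a b c = β x (christoffelForm β x a b) c + β x b (christoffelForm β x a c) := by
  rw [hs x b, apply_christoffelForm hβ, apply_christoffelForm hβ, koszulForm_apply,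
    koszulForm_apply, fderiv_symm_of_symm hd hs a c b, fderiv_symm_of_symm hd hs c a b,
    fderiv_symm_of_symm hd hs b a c]
  ring

theorem christoffelForm_symm (hd : DifferentiableAt ℝ β x) (hs : ∀ x a b, β x a b = β x b a)
    (a b : E) : christoffelForm β x a b = christoffelForm β x b a := by
  have hK : koszulForm β x a b = koszulForm β x b a := by
    ext c
    rw [koszulForm_apply, koszulForm_apply, fderiv_symm_of_symm hd hs c a b]
    ring
  exact congrArg (β x).inverse hK

theorem contDiffAt_christoffelForm [CompleteSpace E] (hd : ContDiffAt ℝ ∞ β x)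
    (hβ : (β x).IsInvertible) : ContDiffAt ℝ ∞ (christoffelForm β) x := by
  have h_fderiv : ContDiffAt ℝ ∞ (fderiv ℝ β) x := hd.fderiv_right (by simp)
  have h_flip : ContDiffAt ℝ ∞ (fun x => (fderiv ℝ β x).flip) x :=
    (ContinuousLinearMap.flipₗᵢ ℝ E E (E →L[ℝ] ℝ)).contDiff.contDiffAt.comp x h_fderiv
  have h_koszul : ContDiffAt ℝ ∞ (koszulForm β) x :=
    ((h_fderiv.add h_flip).sub (contDiffAt_const.clm_comp h_flip)).const_smul _
  have h_inverse : ContDiffAt ℝ ∞ (fun x => (β x).inverse) x :=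
    (hβ.contDiffAt_map_inverse (n := ∞)).comp x hd
  exact ((ContinuousLinearMap.compL ℝ E (E →L[ℝ] ℝ) E).contDiff.contDiffAt.comp x
    h_inverse).clm_comp h_koszul

end Christoffel

section Metric

variable {β : E → F →L[ℝ] F →L[ℝ] ℝ} {Γ : E → E →L[ℝ] F →L[ℝ] F} {x : E}

theorem fderiv_fderiv_of_compatible (hβ : ContDiffAt ℝ 2 β x) (hΓ : DifferentiableAt ℝ Γ x)
    (hc : ∀ᶠ z in 𝓝 x, ∀ a c d, fderiv ℝ β z a c d = β z (Γ z a c) d + β z c (Γ z a d))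
    (a b : E) (c d : F) : fderiv ℝ (fderiv ℝ β) x a b c d =
      fderiv ℝ β x a (Γ x b c) d + β x (fderiv ℝ Γ x a b c) d
        + fderiv ℝ β x a c (Γ x b d) + β x c (fderiv ℝ Γ x a b d) := by
  have hβ₁ : DifferentiableAt ℝ β x := hβ.differentiableAt (by simp)
  have hβ₂ : DifferentiableAt ℝ (fderiv ℝ β) x :=
    (hβ.fderiv_right (m := 1) (by norm_num)).differentiableAt (by simp)
  have hΓd : ∀ c, DifferentiableAt ℝ (fun z => Γ z b c) x := fun c => by fun_prop
  have hev : (fun z => fderiv ℝ β z b c d) =ᶠ[𝓝 x]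
      fun z => β z (Γ z b c) d + β z c (Γ z b d) := hc.mono fun z hz => hz b c d
  have hL : DifferentiableAt ℝ (fun z => β z (Γ z b c) d) x := by fun_prop
  have hR : DifferentiableAt ℝ (fun z => β z c (Γ z b d)) x := by fun_prop
  have hB : DifferentiableAt ℝ (fun z => fderiv ℝ β z b) x := by fun_prop
  have hab := congrArg (fun L : E →L[ℝ] ℝ => L a) hev.fderiv_eq
  rw [fderiv_fun_add hL hR, _root_.add_apply,
    fderiv_clm_apply₂ hβ₁ (hΓd c) (differentiableAt_const d),
    fderiv_clm_apply₂ hβ₁ (differentiableAt_const c) (hΓd d), fderiv_clm_apply₂_const hB,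
    fderiv_clm_apply_const hβ₂, fderiv_clm_apply₂_const hΓ, fderiv_clm_apply₂_const hΓ] at hab
  simpa [add_assoc] using hab

theorem curvatureForm_antisymm (hβ : ContDiffAt ℝ 2 β x) (hΓ : DifferentiableAt ℝ Γ x)
    (hc : ∀ᶠ z in 𝓝 x, ∀ a c d, fderiv ℝ β z a c d = β z (Γ z a c) d + β z c (Γ z a d))
    (a b : E) (c d : F) :
    β x (curvatureForm Γ x a b c) d + β x c (curvatureForm Γ x a b d) = 0 := by
  have hsymm : ∀ a b : E, fderiv ℝ (fderiv ℝ β) x a b = fderiv ℝ (fderiv ℝ β) x b a :=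
    hβ.isSymmSndFDerivAt (by simp)
  have hab := fderiv_fderiv_of_compatible hβ hΓ hc a b c d
  rw [hsymm a b, fderiv_fderiv_of_compatible hβ hΓ hc b a c d] at hab
  simp only [hc.self_of_nhds] at hab
  simp only [curvatureForm, map_sub, map_add, _root_.sub_apply, _root_.add_apply]
  linarith

end Metric

section Along

variable {Γ : F → F →L[ℝ] G →L[ℝ] G} {ψ : E → F} {ν σ : E → G} {x : E}

theorem covDerivForm_apply (u : E) :
    covDerivForm Γ ψ ν x u = fderiv ℝ ν x u + Γ (ψ x) (fderiv ℝ ψ x u) (ν x) := rfl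

theorem covDerivForm_congr {ψ' : E → F} (hψ : ψ =ᶠ[𝓝 x] ψ') (hν : ν =ᶠ[𝓝 x] σ) :
    covDerivForm Γ ψ ν x = covDerivForm Γ ψ' σ x := by
  rw [covDerivForm, covDerivForm, hψ.fderiv_eq, hν.fderiv_eq, hψ.self_of_nhds, hν.self_of_nhds]

theorem covDerivForm_smul {f : E → ℝ} (hf : DifferentiableAt ℝ f x) (hν : DifferentiableAt ℝ ν x)
    (u : E) : covDerivForm Γ ψ (fun z => f z • ν z) x u =
      f x • covDerivForm Γ ψ ν x u + fderiv ℝ f x u • ν x := by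
  simp only [covDerivForm_apply, fderiv_fun_smul hf hν, _root_.add_apply, _root_.smul_apply,
    ContinuousLinearMap.smulRight_apply, map_smul, smul_add]
  abel

theorem fderiv_apply_covDerivForm {β : F → G →L[ℝ] G →L[ℝ] ℝ}
    (hβ : DifferentiableAt ℝ β (ψ x)) (hψ : DifferentiableAt ℝ ψ x)
    (hν : DifferentiableAt ℝ ν x) (hσ : DifferentiableAt ℝ σ x)
    (hc : ∀ a c d, fderiv ℝ β (ψ x) a c d = β (ψ x) (Γ (ψ x) a c) d + β (ψ x) c (Γ (ψ x) a d))
    (u : E) : fderiv ℝ (fun z => β (ψ z) (ν z) (σ z)) x u =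
      β (ψ x) (covDerivForm Γ ψ ν x u) (σ x) + β (ψ x) (ν x) (covDerivForm Γ ψ σ x u) := by
  rw [fderiv_clm_apply₂ (B := fun z => β (ψ z)) (hβ.comp x hψ) hν hσ,
    show fderiv ℝ (fun z => β (ψ z)) x u = fderiv ℝ β (ψ x) (fderiv ℝ ψ x u) from
      congrArg (fun L => L u) (fderiv_comp x hβ hψ), hc]
  simp only [covDerivForm_apply, map_add, _root_.add_apply]
  ring

theorem covDerivForm_covDerivForm (hΓ : DifferentiableAt ℝ Γ (ψ x)) (hψ : ContDiffAt ℝ 2 ψ x)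
    (hν : ContDiffAt ℝ 2 ν x) (u v : E) :
    covDerivForm Γ ψ (fun z => covDerivForm Γ ψ ν z v) x u =
      fderiv ℝ (fderiv ℝ ν) x u v + Γ (ψ x) (fderiv ℝ (fderiv ℝ ψ) x u v) (ν x)
        + fderiv ℝ Γ (ψ x) (fderiv ℝ ψ x u) (fderiv ℝ ψ x v) (ν x)
        + Γ (ψ x) (fderiv ℝ ψ x v) (fderiv ℝ ν x u) + Γ (ψ x) (fderiv ℝ ψ x u) (fderiv ℝ ν x v)
        + Γ (ψ x) (fderiv ℝ ψ x u) (Γ (ψ x) (fderiv ℝ ψ x v) (ν x)) := by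
  have hψ₁ : DifferentiableAt ℝ ψ x := hψ.differentiableAt (by simp)
  have hν₁ : DifferentiableAt ℝ ν x := hν.differentiableAt (by simp)
  have hψ₂ : DifferentiableAt ℝ (fderiv ℝ ψ) x :=
    (hψ.fderiv_right (m := 1) (by norm_num)).differentiableAt (by simp)
  have hν₂ : DifferentiableAt ℝ (fderiv ℝ ν) x :=
    (hν.fderiv_right (m := 1) (by norm_num)).differentiableAt (by simp)
  have hΓψ : DifferentiableAt ℝ (fun z => Γ (ψ z)) x := hΓ.comp x hψ₁
  have hψv : DifferentiableAt ℝ (fun z => fderiv ℝ ψ z v) x := by fun_prop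
  have hνv : DifferentiableAt ℝ (fun z => fderiv ℝ ν z v) x := by fun_prop
  have hΓψν : DifferentiableAt ℝ (fun z => Γ (ψ z) (fderiv ℝ ψ z v) (ν z)) x := by fun_prop
  simp only [covDerivForm_apply]
  rw [fderiv_fun_add hνv hΓψν, _root_.add_apply, fderiv_clm_apply₂ hΓψ hψv hν₁,
    fderiv_clm_apply_const hν₂, fderiv_clm_apply_const hψ₂,
    show fderiv ℝ (fun z => Γ (ψ z)) x u = fderiv ℝ Γ (ψ x) (fderiv ℝ ψ x u) from
      congrArg (fun L => L u) (fderiv_comp x hΓ hψ₁), map_add]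
  abel

theorem covDerivForm_covDerivForm_sub (hΓ : DifferentiableAt ℝ Γ (ψ x)) (hψ : ContDiffAt ℝ 2 ψ x)
    (hν : ContDiffAt ℝ 2 ν x) (u v : E) :
    covDerivForm Γ ψ (fun z => covDerivForm Γ ψ ν z v) x u
        - covDerivForm Γ ψ (fun z => covDerivForm Γ ψ ν z u) x v =
      curvatureForm Γ (ψ x) (fderiv ℝ ψ x u) (fderiv ℝ ψ x v) (ν x) := by
  have hψs : fderiv ℝ (fderiv ℝ ψ) x u v = fderiv ℝ (fderiv ℝ ψ) x v u :=
    hψ.isSymmSndFDerivAt (by simp) u v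
  have hνs : fderiv ℝ (fderiv ℝ ν) x u v = fderiv ℝ (fderiv ℝ ν) x v u :=
    hν.isSymmSndFDerivAt (by simp) u v
  rw [covDerivForm_covDerivForm hΓ hψ hν, covDerivForm_covDerivForm hΓ hψ hν, hψs, hνs,
    curvatureForm]
  abel

end Along

section TorsionFree

variable {Γ : F → F →L[ℝ] F →L[ℝ] F} {ψ : E → F} {x : E}

theorem covDerivForm_fderiv (hψ : ContDiffAt ℝ 2 ψ x) (u v : E) :
    covDerivForm Γ ψ (fun z => fderiv ℝ ψ z v) x u =
      fderiv ℝ (fderiv ℝ ψ) x u v + Γ (ψ x) (fderiv ℝ ψ x u) (fderiv ℝ ψ x v) := by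
  rw [covDerivForm_apply, fderiv_clm_apply_const
    ((hψ.fderiv_right (m := 1) (by norm_num)).differentiableAt (by simp))]

theorem covDerivForm_fderiv_comm (hs : ∀ a b, Γ (ψ x) a b = Γ (ψ x) b a) (hψ : ContDiffAt ℝ 2 ψ x)
    (u v : E) : covDerivForm Γ ψ (fun z => fderiv ℝ ψ z v) x u =
      covDerivForm Γ ψ (fun z => fderiv ℝ ψ z u) x v := by
  have hψs : fderiv ℝ (fderiv ℝ ψ) x u v = fderiv ℝ (fderiv ℝ ψ) x v u :=
    hψ.isSymmSndFDerivAt (by simp) u v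
  rw [covDerivForm_fderiv hψ, covDerivForm_fderiv hψ, hψs, hs]

theorem curvatureForm_of_covDerivForm_eq {ν : E → F} {k : E → ℝ}
    (hΓ : DifferentiableAt ℝ Γ (ψ x)) (hs : ∀ a b, Γ (ψ x) a b = Γ (ψ x) b a)
    (hψ : ContDiffAt ℝ 2 ψ x) (hν : ContDiffAt ℝ 2 ν x) (hk : DifferentiableAt ℝ k x)
    (he : ∀ᶠ z in 𝓝 x, ∀ v, covDerivForm Γ ψ ν z v = k z • fderiv ℝ ψ z v) (u v : E) :
    curvatureForm Γ (ψ x) (fderiv ℝ ψ x u) (fderiv ℝ ψ x v) (ν x) =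
      fderiv ℝ k x u • fderiv ℝ ψ x v - fderiv ℝ k x v • fderiv ℝ ψ x u := by
  have hψ₂ : DifferentiableAt ℝ (fderiv ℝ ψ) x :=
    (hψ.fderiv_right (m := 1) (by norm_num)).differentiableAt (by simp)
  have hcov : ∀ a b, covDerivForm Γ ψ (fun z => covDerivForm Γ ψ ν z b) x a =
      k x • covDerivForm Γ ψ (fun z => fderiv ℝ ψ z b) x a + fderiv ℝ k x a • fderiv ℝ ψ x b := by
    intro a b
    rw [covDerivForm_congr .rfl (he.mono fun z hz => hz b), covDerivForm_smul hk (by fun_prop)]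
  rw [← covDerivForm_covDerivForm_sub hΓ hψ hν, hcov, hcov, covDerivForm_fderiv_comm hs hψ u v]
  abel

end TorsionFree

section Hessian

variable {Γ' : E → E →L[ℝ] E →L[ℝ] E} {Γ : F → F →L[ℝ] F →L[ℝ] F} {ψ : E → F} {x : E}

/-- The Hessian `∇dψ` of a map between open sets of vector spaces, with respect to connections with
Christoffel forms `Γ'` on the source and `Γ` on the target. -/
def hessianForm (Γ' : E → E →L[ℝ] E →L[ℝ] E) (Γ : F → F →L[ℝ] F →L[ℝ] F) (ψ : E → F) (x : E) :
    E →ₗ[ℝ] E →ₗ[ℝ] F :=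
  LinearMap.mk₂ ℝ (fun u v => fderiv ℝ (fderiv ℝ ψ) x u v +
      Γ (ψ x) (fderiv ℝ ψ x u) (fderiv ℝ ψ x v) - fderiv ℝ ψ x (Γ' x u v))
    (fun _ _ _ => by simp only [map_add, _root_.add_apply]; abel)
    (fun _ _ _ => by simp only [map_smul, _root_.smul_apply, smul_add, smul_sub])
    (fun _ _ _ => by simp only [map_add]; abel)
    (fun _ _ _ => by simp only [map_smul, smul_add, smul_sub])

theorem hessianForm_apply (u v : E) :
    hessianForm Γ' Γ ψ x u v = fderiv ℝ (fderiv ℝ ψ) x u v +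
      Γ (ψ x) (fderiv ℝ ψ x u) (fderiv ℝ ψ x v) - fderiv ℝ ψ x (Γ' x u v) := rfl

theorem covDerivForm_fderiv_sub {ν : E → E} (hψ : ContDiffAt ℝ 2 ψ x)
    (hν : DifferentiableAt ℝ ν x) (u : E) :
    covDerivForm Γ ψ (fun z => fderiv ℝ ψ z (ν z)) x u - fderiv ℝ ψ x (covDerivForm Γ' id ν x u) =
      hessianForm Γ' Γ ψ x u (ν x) := by
  have hψ₂ : DifferentiableAt ℝ (fderiv ℝ ψ) x :=
    (hψ.fderiv_right (m := 1) (by norm_num)).differentiableAt (by simp)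
  have hprod := (hψ₂.hasFDerivAt.clm_apply hν.hasFDerivAt).fderiv
  rw [hessianForm_apply, covDerivForm_apply, covDerivForm_apply, hprod, fderiv_id]
  simp only [map_add, _root_.add_apply, ContinuousLinearMap.comp_apply,
    ContinuousLinearMap.flip_apply, id, ContinuousLinearMap.id_apply]
  abel

theorem contDiffAt_hessianForm (hΓ' : ContDiffAt ℝ ∞ Γ' x) (hΓ : ContDiffAt ℝ ∞ Γ (ψ x))
    (hψ : ContDiffAt ℝ ∞ ψ x) {ν σ : E → E} (hν : ContDiffAt ℝ ∞ ν x) (hσ : ContDiffAt ℝ ∞ σ x) :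
    ContDiffAt ℝ ∞ (fun z => hessianForm Γ' Γ ψ z (ν z) (σ z)) x := by
  have hψ₁ : ContDiffAt ℝ ∞ (fderiv ℝ ψ) x := hψ.fderiv_right (by simp)
  have hψ₂ : ContDiffAt ℝ ∞ (fderiv ℝ (fderiv ℝ ψ)) x := hψ₁.fderiv_right (by simp)
  exact (((hψ₂.clm_apply hν).clm_apply hσ).add (((hΓ.comp x hψ).clm_apply
    (hψ₁.clm_apply hν)).clm_apply (hψ₁.clm_apply hσ))).sub
      (hψ₁.clm_apply ((hΓ'.clm_apply hν).clm_apply hσ))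

end Hessian

end Euclidean

/-! ### Functions, maps and sections in charts -/

section Coordinates

variable {n : ℕ} {M : Type*} [TopologicalSpace M] [ChartedSpace (EuclideanSpace ℝ (Fin n)) M]
  {p q : M} {F : Type*}

variable (n) in
/-- A function on `M` read in the chart at `p`. -/
def localFun (f : M → F) (p : M) (x : EuclideanSpace ℝ (Fin n)) : F :=
  f ((extChartAt (𝓡 n) p).symm x)

theorem localFun_apply {f : M → F} (hq : q ∈ (extChartAt (𝓡 n) p).source) :
    localFun n f p (extChartAt (𝓡 n) p q) = f q := by
  rw [localFun, (extChartAt (𝓡 n) p).left_inv hq]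

theorem eventually_mem_target (hq : q ∈ (extChartAt (𝓡 n) p).source) :
    ∀ᶠ x in 𝓝 (extChartAt (𝓡 n) p q), x ∈ (extChartAt (𝓡 n) p).target :=
  (isOpen_extChartAt_target p).mem_nhds ((extChartAt (𝓡 n) p).map_source hq)

variable [NormedAddCommGroup F] [NormedSpace ℝ F]

theorem dirDeriv_congr {f f' : M → F} (hf : f =ᶠ[𝓝 q] f') (v : TangentSpace (𝓡 n) q) :
    dirDeriv f q v = dirDeriv f' q v :=
  congrArg (fun L : EuclideanSpace ℝ (Fin n) →L[ℝ] F => L v) hf.mfderiv_eq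

theorem dirDeriv_const (c : F) (v : TangentSpace (𝓡 n) q) : dirDeriv (fun _ => c) q v = 0 :=
  congrArg (fun L : EuclideanSpace ℝ (Fin n) →L[ℝ] F => L v)
    (mfderiv_const (I := 𝓡 n) (I' := 𝓘(ℝ, F)) (c := c) (x := q))

variable [IsManifold (𝓡 n) ∞ M]

/-- The coordinate frame of the chart at `p`, evaluated at `q`. -/
def frame (p q : M) : EuclideanSpace ℝ (Fin n) →L[ℝ] TangentSpace (𝓡 n) q :=
  (trivializationAt (EuclideanSpace ℝ (Fin n)) (TangentSpace (𝓡 n) : M → Type _) p).symmL ℝ q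

/-- The coefficients of a tangent vector at `q` in the coordinate frame of the chart at `p`. -/
def coframe (p q : M) : TangentSpace (𝓡 n) q →L[ℝ] EuclideanSpace ℝ (Fin n) :=
  (trivializationAt (EuclideanSpace ℝ (Fin n))
    (TangentSpace (𝓡 n) : M → Type _) p).continuousLinearMapAt ℝ q

theorem coframe_frame (hq : q ∈ (extChartAt (𝓡 n) p).source) (v : EuclideanSpace ℝ (Fin n)) :
    coframe p q (frame p q v) = v :=
  (trivializationAt (EuclideanSpace ℝ (Fin n))
    (TangentSpace (𝓡 n) : M → Type _) p).continuousLinearMapAt_symmL (by simpa using hq) v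

theorem frame_coframe (hq : q ∈ (extChartAt (𝓡 n) p).source) (v : TangentSpace (𝓡 n) q) :
    frame p q (coframe p q v) = v :=
  (trivializationAt (EuclideanSpace ℝ (Fin n))
    (TangentSpace (𝓡 n) : M → Type _) p).symmL_continuousLinearMapAt (by simpa using hq) v

theorem coframe_eq_mfderiv (hq : q ∈ (extChartAt (𝓡 n) p).source) :
    coframe p q = mfderiv (𝓡 n) 𝓘(ℝ, EuclideanSpace ℝ (Fin n)) (extChartAt (𝓡 n) p) q :=
  TangentBundle.continuousLinearMapAt_trivializationAt (by simpa using hq)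

theorem frame_eq_mfderiv (hq : q ∈ (extChartAt (𝓡 n) p).source) :
    frame p q = mfderiv 𝓘(ℝ, EuclideanSpace ℝ (Fin n)) (𝓡 n) (extChartAt (𝓡 n) p).symm
      (extChartAt (𝓡 n) p q) := by
  rw [← mfderivWithin_univ, frame, TangentBundle.symmL_trivializationAt (by simpa using hq),
    modelWithCornersSelf_coe, Set.range_id]

theorem coframe_self (v : TangentSpace (𝓡 n) p) : coframe p p v = v := by
  rw [coframe_eq_mfderiv (mem_extChartAt_source p), mfderiv_extChartAt_self]
  rfl

theorem frame_self (v : EuclideanSpace ℝ (Fin n)) : frame p p v = v :=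
  (congrArg (frame p p) (coframe_self (p := p) v)).symm.trans
    (frame_coframe (mem_extChartAt_source (I := 𝓡 n) p) (v : TangentSpace (𝓡 n) p))

theorem coordField_self (v : TangentSpace (𝓡 n) p) : coordField p v p = v := frame_self v

theorem mdifferentiableAt_extChartAt_symm {x : EuclideanSpace ℝ (Fin n)}
    (hx : x ∈ (extChartAt (𝓡 n) p).target) :
    MDifferentiableAt 𝓘(ℝ, EuclideanSpace ℝ (Fin n)) (𝓡 n) (extChartAt (𝓡 n) p).symm x := by
  simpa [mdifferentiableWithinAt_univ] using mdifferentiableWithinAt_extChartAt_symm (I := 𝓡 n) hx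

theorem contMDiffAt_extChartAt_symm {x : EuclideanSpace ℝ (Fin n)}
    (hx : x ∈ (extChartAt (𝓡 n) p).target) :
    ContMDiffAt 𝓘(ℝ, EuclideanSpace ℝ (Fin n)) (𝓡 n) ∞ (extChartAt (𝓡 n) p).symm x :=
  (contMDiffOn_extChartAt_symm p).contMDiffAt ((isOpen_extChartAt_target p).mem_nhds hx)

theorem contMDiffAt_extChartAt_of_mem (hq : q ∈ (extChartAt (𝓡 n) p).source) :
    ContMDiffAt (𝓡 n) 𝓘(ℝ, EuclideanSpace ℝ (Fin n)) ∞ (extChartAt (𝓡 n) p) q :=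
  contMDiffAt_extChartAt' (by simpa using hq)

theorem differentiableAt_localFun {f : M → F} (hq : q ∈ (extChartAt (𝓡 n) p).source)
    (hf : MDifferentiableAt (𝓡 n) 𝓘(ℝ, F) f q) :
    DifferentiableAt ℝ (localFun n f p) (extChartAt (𝓡 n) p q) := by
  rw [← mdifferentiableAt_iff_differentiableAt]
  exact hf.comp_of_eq (I' := 𝓡 n)
    (hf := mdifferentiableAt_extChartAt_symm ((extChartAt (𝓡 n) p).map_source hq))
    (hy := (extChartAt (𝓡 n) p).left_inv hq)

theorem dirDeriv_frame {f : M → F} (hq : q ∈ (extChartAt (𝓡 n) p).source)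
    (hf : MDifferentiableAt (𝓡 n) 𝓘(ℝ, F) f q) (u : EuclideanSpace ℝ (Fin n)) :
    dirDeriv f q (frame p q u) = fderiv ℝ (localFun n f p) (extChartAt (𝓡 n) p q) u := by
  have hinv := (extChartAt (𝓡 n) p).left_inv hq
  have hcomp := mfderiv_comp_of_eq (I := 𝓘(ℝ, EuclideanSpace ℝ (Fin n))) (I' := 𝓡 n)
    (I'' := 𝓘(ℝ, F)) (x := extChartAt (𝓡 n) p q) (g := f) hf
    (mdifferentiableAt_extChartAt_symm ((extChartAt (𝓡 n) p).map_source hq)) hinv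
  rw [← mfderiv_eq_fderiv, frame_eq_mfderiv hq, dirDeriv]
  change _ = mfderiv _ _ (f ∘ (extChartAt (𝓡 n) p).symm) _ u
  rw [hcomp, hinv]
  rfl

theorem contDiffAt_localFun {k : ℕ∞ω} (hk : k ≤ ∞) {f : M → F}
    (hq : q ∈ (extChartAt (𝓡 n) p).source)
    (hf : ContMDiffAt (𝓡 n) 𝓘(ℝ, F) k f q) :
    ContDiffAt ℝ k (localFun n f p) (extChartAt (𝓡 n) p q) := by
  rw [← contMDiffAt_iff_contDiffAt]
  refine ContMDiffAt.comp_of_eq (I' := 𝓡 n) hf ?_ ((extChartAt (𝓡 n) p).left_inv hq)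
  exact (contMDiffAt_extChartAt_symm ((extChartAt (𝓡 n) p).map_source hq)).of_le hk

theorem contMDiffAt_of_contDiffAt_localFun {k : ℕ∞ω} (hk : k ≤ ∞) {f : M → F}
    (hq : q ∈ (extChartAt (𝓡 n) p).source)
    (hf : ContDiffAt ℝ k (localFun n f p) (extChartAt (𝓡 n) p q)) :
    ContMDiffAt (𝓡 n) 𝓘(ℝ, F) k f q := by
  refine (hf.contMDiffAt.comp q
    ((contMDiffAt_extChartAt_of_mem hq).of_le hk)).congr_of_eventuallyEq ?_
  filter_upwards [(isOpen_extChartAt_source (I := 𝓡 n) p).mem_nhds hq] with r hr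
  rw [Function.comp_apply, localFun_apply hr]

end Coordinates

section Maps

variable {m n : ℕ}
  {M : Type*} [TopologicalSpace M] [ChartedSpace (EuclideanSpace ℝ (Fin m)) M]
  {N : Type*} [TopologicalSpace N] [ChartedSpace (EuclideanSpace ℝ (Fin n)) N]
  {φ : M → N} {p q : M} {y : N} {k : ℕ∞ω}

variable (m n) in
/-- A map read in the charts at `p` and `y`. -/
def localMap (φ : M → N) (p : M) (y : N) (x : EuclideanSpace ℝ (Fin m)) :
    EuclideanSpace ℝ (Fin n) :=
  extChartAt (𝓡 n) y (φ ((extChartAt (𝓡 m) p).symm x))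

theorem localMap_apply (hq : q ∈ (extChartAt (𝓡 m) p).source) :
    localMap m n φ p y (extChartAt (𝓡 m) p q) = extChartAt (𝓡 n) y (φ q) := by
  rw [localMap, (extChartAt (𝓡 m) p).left_inv hq]

theorem eventually_mem_source (hφ : ContinuousAt φ q) (hy : φ q ∈ (extChartAt (𝓡 n) y).source) :
    ∀ᶠ r in 𝓝 q, φ r ∈ (extChartAt (𝓡 n) y).source :=
  hφ.preimage_mem_nhds ((isOpen_extChartAt_source (I := 𝓡 n) y).mem_nhds hy)

theorem dirDeriv_comp {F : Type*} [NormedAddCommGroup F] [NormedSpace ℝ F] {f : N → F}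
    (hf : MDifferentiableAt (𝓡 n) 𝓘(ℝ, F) f (φ q)) (hφ : MDifferentiableAt (𝓡 m) (𝓡 n) φ q)
    (v : TangentSpace (𝓡 m) q) :
    dirDeriv (fun r => f (φ r)) q v = dirDeriv (n := n) f (φ q) (differential φ q v) :=
  congrArg (fun L : EuclideanSpace ℝ (Fin m) →L[ℝ] F => L v)
    (mfderiv_comp (I := 𝓡 m) (I' := 𝓡 n) (I'' := 𝓘(ℝ, F)) q hf hφ)

theorem differential_id (v : TangentSpace (𝓡 m) q) : differential (fun r : M => r) q v = v :=
  congrArg (fun L : EuclideanSpace ℝ (Fin m) →L[ℝ] EuclideanSpace ℝ (Fin m) => L v)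
    (mfderiv_id (I := 𝓡 m) (x := q))

variable [IsManifold (𝓡 n) ∞ N] {V : Π q : M, TangentSpace (𝓡 n) (φ q)}

variable (m) in
/-- A section along `φ`, read in the charts at `p` and `y`. -/
def localSection (φ : M → N) (V : Π q : M, TangentSpace (𝓡 n) (φ q)) (p : M) (y : N)
    (x : EuclideanSpace ℝ (Fin m)) : EuclideanSpace ℝ (Fin n) :=
  coframe y (φ ((extChartAt (𝓡 m) p).symm x)) (V ((extChartAt (𝓡 m) p).symm x))

variable (m) in
/-- Smoothness at `q` of a section along `φ`. -/
def SmoothAt (φ : M → N) (V : Π q : M, TangentSpace (𝓡 n) (φ q)) (q : M) : Prop :=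
  ContMDiffAt (𝓡 m) (𝓡 n).tangent ∞ (fun r => (⟨φ r, V r⟩ : TangentBundle (𝓡 n) N)) q

theorem localSection_apply (hq : q ∈ (extChartAt (𝓡 m) p).source) :
    localSection m φ V p y (extChartAt (𝓡 m) p q) = coframe y (φ q) (V q) := by
  rw [localSection, (extChartAt (𝓡 m) p).left_inv hq]

theorem trivializationAt_snd {z : N} (hz : z ∈ (extChartAt (𝓡 n) y).source)
    (w : TangentSpace (𝓡 n) z) :
    (trivializationAt (EuclideanSpace ℝ (Fin n)) (TangentSpace (𝓡 n) : N → Type _) y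
      (⟨z, w⟩ : TangentBundle (𝓡 n) N)).2 = coframe y z w := by
  rw [coframe, Bundle.Trivialization.continuousLinearMapAt_apply,
    Bundle.Trivialization.coe_linearMapAt_of_mem _ (by simpa using hz)]

theorem smoothAt_iff_of_mem (hy : φ q ∈ (extChartAt (𝓡 n) y).source) :
    SmoothAt m φ V q ↔ ContMDiffAt (𝓡 m) (𝓡 n) ∞ φ q ∧
      ContMDiffAt (𝓡 m) 𝓘(ℝ, EuclideanSpace ℝ (Fin n)) ∞ (fun r => coframe y (φ r) (V r)) q := by
  have htriv := (trivializationAt (EuclideanSpace ℝ (Fin n))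
    (TangentSpace (𝓡 n) : N → Type _) y).contMDiffAt_iff (IM := 𝓡 m) (IB := 𝓡 n) (n := ∞)
    (f := fun r => (⟨φ r, V r⟩ : TangentBundle (𝓡 n) N)) (x₀ := q) (by
      rw [Bundle.Trivialization.mem_source]; simpa using hy)
  refine htriv.trans (and_congr_right fun hφ => Filter.EventuallyEq.contMDiffAt_iff ?_)
  filter_upwards [eventually_mem_source hφ.continuousAt hy] with r hr
  exact trivializationAt_snd hr _

theorem SmoothAt.base (hV : SmoothAt m φ V q) : ContMDiffAt (𝓡 m) (𝓡 n) ∞ φ q :=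
  ((smoothAt_iff_of_mem (mem_extChartAt_source (φ q))).1 hV).1

theorem smoothAt_coordField {v : TangentSpace (𝓡 n) y} {z : N}
    (hz : z ∈ (extChartAt (𝓡 n) y).source) : SmoothAt n (fun r : N => r) (coordField y v) z := by
  refine (smoothAt_iff_of_mem hz).2 ⟨contMDiffAt_id, ?_⟩
  have hc : ContMDiffAt (𝓡 n) 𝓘(ℝ, EuclideanSpace ℝ (Fin n)) ∞
    (fun _ : N => (show EuclideanSpace ℝ (Fin n) from v)) z := contMDiffAt_const
  refine hc.congr_of_eventuallyEq ?_
  filter_upwards [eventually_mem_source continuousAt_id hz] with r hr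
  exact coframe_frame hr v

variable [IsManifold (𝓡 m) ∞ M]

theorem contDiffAt_localMap (hk : k ≤ ∞) (hq : q ∈ (extChartAt (𝓡 m) p).source)
    (hy : φ q ∈ (extChartAt (𝓡 n) y).source) (hφ : ContMDiffAt (𝓡 m) (𝓡 n) k φ q) :
    ContDiffAt ℝ k (localMap m n φ p y) (extChartAt (𝓡 m) p q) :=
  contDiffAt_localFun (n := m) (f := fun r => extChartAt (𝓡 n) y (φ r)) hk hq
    (((contMDiffAt_extChartAt_of_mem (n := n) hy).of_le hk).comp q hφ)

theorem coframe_differential (hq : q ∈ (extChartAt (𝓡 m) p).source)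
    (hy : φ q ∈ (extChartAt (𝓡 n) y).source) (hφ : MDifferentiableAt (𝓡 m) (𝓡 n) φ q)
    (u : EuclideanSpace ℝ (Fin m)) :
    coframe y (φ q) (differential φ q (frame p q u)) =
      fderiv ℝ (localMap m n φ p y) (extChartAt (𝓡 m) p q) u := by
  have hchart := mdifferentiableAt_extChartAt (I := 𝓡 n) (x := y) (y := φ q) (by simpa using hy)
  change _ = fderiv ℝ (localFun m (fun r => extChartAt (𝓡 n) y (φ r)) p) _ u
  rw [← dirDeriv_frame (f := fun r => extChartAt (𝓡 n) y (φ r)) hq (hchart.comp q hφ),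
    dirDeriv_comp hchart hφ, coframe_eq_mfderiv hy]
  rfl

theorem SmoothAt.contDiffAt (hV : SmoothAt m φ V q) (hq : q ∈ (extChartAt (𝓡 m) p).source)
    (hy : φ q ∈ (extChartAt (𝓡 n) y).source) :
    ContDiffAt ℝ ∞ (localSection m φ V p y) (extChartAt (𝓡 m) p q) :=
  contDiffAt_localFun le_rfl hq ((smoothAt_iff_of_mem hy).1 hV).2

theorem smoothAt_of_contDiffAt (hφ : ContMDiffAt (𝓡 m) (𝓡 n) ∞ φ q)
    (hq : q ∈ (extChartAt (𝓡 m) p).source)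
    (hy : φ q ∈ (extChartAt (𝓡 n) y).source)
    (hV : ContDiffAt ℝ ∞ (localSection m φ V p y) (extChartAt (𝓡 m) p q)) :
    SmoothAt m φ V q :=
  (smoothAt_iff_of_mem hy).2 ⟨hφ, contMDiffAt_of_contDiffAt_localFun le_rfl hq hV⟩

end Maps

/-! ### The metric at a point -/

section MetricAlgebra

open Matrix

variable {n : ℕ} {M : Type*} [TopologicalSpace M] [ChartedSpace (EuclideanSpace ℝ (Fin n)) M]

theorem sum_coordBasis {p : M} (v : TangentSpace (𝓡 n) p) :
    ∑ i, (show EuclideanSpace ℝ (Fin n) from v) i • coordBasis p i = v := by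
  simpa using! (EuclideanSpace.basisFun (Fin n) ℝ).sum_repr (show EuclideanSpace ℝ (Fin n) from v)

variable [IsManifold (𝓡 n) ∞ M] {g : Metric n M} {p : M}

theorem inner_self_eq_zero_iff {v : TangentSpace (𝓡 n) p} : g.inner p v v = 0 ↔ v = 0 := by
  refine ⟨fun h => ?_, fun h => by simp [h]⟩
  by_contra hv
  exact (g.pos p v hv).ne' h

theorem eq_of_inner_eq {v w : TangentSpace (𝓡 n) p}
    (h : ∀ z, g.inner p v z = g.inner p w z) : v = w := by
  rw [← sub_eq_zero, ← inner_self_eq_zero_iff (g := g)]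
  simpa [sub_eq_zero] using h (v - w)

variable (g p) in
/-- `(b, b')` is a pair of finite families for which `v = ∑ ⟨v, b' i⟩ b i`. It serves to compute
metric traces; an orthonormal basis is dual to itself. -/
def IsDualPair {ι : Type*} [Fintype ι] (b b' : ι → TangentSpace (𝓡 n) p) : Prop :=
  ∀ v, ∑ i, g.inner p v (b' i) • b i = v

variable (g p) in
/-- The family `∑ g^{ij} ∂_j` dual to the coordinate basis. -/
def dualBasis (i : Fin n) : TangentSpace (𝓡 n) p :=
  ∑ j, (gram g p)⁻¹ i j • coordBasis p j

theorem gram_symm (i j : Fin n) : gram g p i j = gram g p j i := g.symm p _ _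

theorem gram_mulVec (v : TangentSpace (𝓡 n) p) (i : Fin n) :
    (gram g p *ᵥ (show EuclideanSpace ℝ (Fin n) from v).ofLp) i =
      g.inner p (coordBasis p i) v := by
  conv_rhs => rw [← sum_coordBasis v, map_sum]
  rw [Matrix.mulVec, dotProduct]
  refine Finset.sum_congr rfl fun j _ => ?_
  rw [map_smul, smul_eq_mul, mul_comm]
  rfl

theorem isUnit_gram : IsUnit (gram g p) := by
  rw [← Matrix.mulVec_injective_iff_isUnit, ← Matrix.coe_mulVecLin, injective_iff_map_eq_zero]
  intro x hx
  let v : TangentSpace (𝓡 n) p := WithLp.toLp 2 x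
  have hbasis : ∀ i, g.inner p v (coordBasis p i) = 0 := fun i => by
    rw [g.symm, ← gram_mulVec]
    exact congrFun hx i
  have hv : v = 0 := by
    rw [← inner_self_eq_zero_iff (g := g)]
    conv_lhs => enter [2]; rw [← sum_coordBasis v]
    simp only [map_sum, map_smul, hbasis, smul_zero, Finset.sum_const_zero]
  exact congrArg (fun w : EuclideanSpace ℝ (Fin n) => w.ofLp) hv

theorem inner_coordBasis_dualBasis (i k : Fin n) :
    g.inner p (coordBasis p k) (dualBasis g p i) = if i = k then 1 else 0 := by
  have hG : (gram g p)⁻¹ * gram g p = 1 :=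
    Matrix.nonsing_inv_mul _ ((Matrix.isUnit_iff_isUnit_det _).1 isUnit_gram)
  rw [← Matrix.one_apply, ← hG, Matrix.mul_apply, dualBasis, map_sum]
  exact Finset.sum_congr rfl fun j _ => by rw [map_smul, smul_eq_mul, gram_symm]; rfl

theorem isDualPair_coordBasis : IsDualPair g p (coordBasis p) (dualBasis g p) := by
  intro v
  conv_rhs => rw [← sum_coordBasis v]
  refine Finset.sum_congr rfl fun i _ => congrArg (· • coordBasis p i) ?_
  conv_lhs => rw [← sum_coordBasis v]
  simp [map_sum, _root_.sum_apply, inner_coordBasis_dualBasis]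

variable {ι : Type*} [Fintype ι] {b b' : ι → TangentSpace (𝓡 n) p}

theorem IsDualPair.symm (h : IsDualPair g p b b') : IsDualPair g p b' b := by
  intro v
  refine eq_of_inner_eq (g := g) fun z => ?_
  conv_rhs => rw [← h z]
  rw [map_sum, _root_.sum_apply, map_sum]
  refine Finset.sum_congr rfl fun i _ => ?_
  rw [map_smul, map_smul, _root_.smul_apply, smul_eq_mul, smul_eq_mul, mul_comm,
    g.symm p (b' i) z]

theorem metricTrace_eq_sum {W : Type*} [AddCommGroup W] [Module ℝ W] (h : IsDualPair g p b b')
    (B : TangentSpace (𝓡 n) p →ₗ[ℝ] TangentSpace (𝓡 n) p →ₗ[ℝ] W) :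
    metricTrace g p (fun u v => B u v) = ∑ i, B (b i) (b' i) := by
  calc metricTrace g p (fun u v => B u v) = ∑ i, B (coordBasis p i) (dualBasis g p i) := by
        simp only [metricTrace, dualBasis, map_sum, map_smul]
    _ = ∑ i, ∑ j, g.inner p (coordBasis p i) (b' j) • B (b j) (dualBasis g p i) := by
        refine Finset.sum_congr rfl fun i _ => ?_
        conv_lhs => rw [← h (coordBasis p i)]
        simp
    _ = ∑ j, ∑ i, B (b j) (g.inner p (b' j) (coordBasis p i) • dualBasis g p i) := by
        rw [Finset.sum_comm]
        simp only [map_smul, g.symm]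
    _ = ∑ j, B (b j) (b' j) := by
        simp only [← map_sum, isDualPair_coordBasis.symm (b' _)]

theorem sum_inner_dualPair (h : IsDualPair g p b b') : ∑ i, g.inner p (b i) (b' i) = n := by
  let B : TangentSpace (𝓡 n) p →ₗ[ℝ] TangentSpace (𝓡 n) p →ₗ[ℝ] ℝ :=
    LinearMap.mk₂ ℝ (fun u v => g.inner p u v) (by simp) (by simp) (by simp) (by simp)
  calc ∑ i, g.inner p (b i) (b' i) = ∑ i, g.inner p (coordBasis p i) (dualBasis g p i) :=
        (metricTrace_eq_sum h B).symm.trans (metricTrace_eq_sum isDualPair_coordBasis B)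
    _ = n := by simp [inner_coordBasis_dualBasis]

theorem inner_sharp (α : TangentSpace (𝓡 n) p →ₗ[ℝ] ℝ) (v : TangentSpace (𝓡 n) p) :
    g.inner p (sharp g p (fun v => α v)) v = α v := by
  have hsharp : sharp g p (fun v => α v) = ∑ i, α (dualBasis g p i) • coordBasis p i := by
    simp only [sharp, dualBasis, map_sum, map_smul, smul_eq_mul, Finset.sum_smul]
  rw [hsharp, map_sum, _root_.sum_apply]
  conv_rhs => rw [← (isDualPair_coordBasis (g := g)).symm v, map_sum]
  refine Finset.sum_congr rfl fun i _ => ?_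
  rw [map_smul, map_smul, _root_.smul_apply, smul_eq_mul, smul_eq_mul, mul_comm,
    g.symm p _ v]

end MetricAlgebra

section LocalMetric

variable {n : ℕ} {N : Type*} [TopologicalSpace N] [ChartedSpace (EuclideanSpace ℝ (Fin n)) N]
  [IsManifold (𝓡 n) ∞ N] {h : Metric n N} {y z : N}

variable (h y) in
/-- The metric read in the chart at `y`. -/
def localMetric (x : EuclideanSpace ℝ (Fin n)) :
    EuclideanSpace ℝ (Fin n) →L[ℝ] EuclideanSpace ℝ (Fin n) →L[ℝ] ℝ :=
  (ContinuousLinearMap.precomp ℝ (frame y ((extChartAt (𝓡 n) y).symm x))).comp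
    ((h.inner ((extChartAt (𝓡 n) y).symm x)).comp (frame y ((extChartAt (𝓡 n) y).symm x)))

theorem localMetric_apply (x u v : EuclideanSpace ℝ (Fin n)) :
    localMetric h y x u v = h.inner ((extChartAt (𝓡 n) y).symm x)
      (frame y ((extChartAt (𝓡 n) y).symm x) u) (frame y ((extChartAt (𝓡 n) y).symm x) v) := rfl

theorem localMetric_extChartAt (hz : z ∈ (extChartAt (𝓡 n) y).source)
    (u v : EuclideanSpace ℝ (Fin n)) :
    localMetric h y (extChartAt (𝓡 n) y z) u v = h.inner z (frame y z u) (frame y z v) := by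
  rw [localMetric_apply, (extChartAt (𝓡 n) y).left_inv hz]

theorem inner_eq_localMetric (hz : z ∈ (extChartAt (𝓡 n) y).source)
    (u v : TangentSpace (𝓡 n) z) :
    h.inner z u v = localMetric h y (extChartAt (𝓡 n) y z) (coframe y z u) (coframe y z v) := by
  rw [localMetric_extChartAt hz, frame_coframe hz, frame_coframe hz]

theorem localMetric_symm (x u v : EuclideanSpace ℝ (Fin n)) :
    localMetric h y x u v = localMetric h y x v u := h.symm _ _ _

theorem contMDiffAt_inner {m : ℕ} {M : Type*} [TopologicalSpace M]
    [ChartedSpace (EuclideanSpace ℝ (Fin m)) M] {φ : M → N} {q : M}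
    {V W : Π q : M, TangentSpace (𝓡 n) (φ q)}
    (hV : SmoothAt m φ V q) (hW : SmoothAt m φ W q) :
    ContMDiffAt (𝓡 m) 𝓘(ℝ, ℝ) ∞ (fun r => h.inner (φ r) (V r) (W r)) q := by
  have htotal : ContMDiffAt (𝓡 m) ((𝓡 n).prod 𝓘(ℝ)) ∞
      (fun r => Bundle.TotalSpace.mk' ℝ (E := Bundle.Trivial N ℝ) (φ r)
        (h.inner (φ r) (V r) (W r))) q := by
    apply ContMDiffAt.clm_bundle_apply₂ (F₁ := EuclideanSpace ℝ (Fin n))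
      (F₂ := EuclideanSpace ℝ (Fin n))
    · exact ContMDiffAt.comp q h.contMDiff.contMDiffAt hV.base
    · exact hV
    · exact hW
  exact (Bundle.contMDiffAt_totalSpace.1 htotal).2

theorem contDiffAt_localMetric {x : EuclideanSpace ℝ (Fin n)}
    (hx : x ∈ (extChartAt (𝓡 n) y).target) : ContDiffAt ℝ ∞ (localMetric h y) x := by
  suffices H : ContDiffOn ℝ ∞ (localMetric h y) (extChartAt (𝓡 n) y).target from
    H.contDiffAt ((isOpen_extChartAt_target y).mem_nhds hx)
  rw [contDiffOn_clm_apply]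
  intro u
  rw [contDiffOn_clm_apply]
  intro v x hx
  have hz := (extChartAt (𝓡 n) y).map_target hx
  have huv := contDiffAt_localFun le_rfl hz (contMDiffAt_inner (h := h) (φ := fun z : N => z)
    (smoothAt_coordField (v := u) hz) (smoothAt_coordField (v := v) hz))
  rw [(extChartAt (𝓡 n) y).right_inv hx] at huv
  exact huv.contDiffWithinAt

theorem isInvertible_localMetric {x : EuclideanSpace ℝ (Fin n)}
    (hx : x ∈ (extChartAt (𝓡 n) y).target) : (localMetric h y x).IsInvertible := by
  have hinj : Function.Injective (localMetric h y x).toLinearMap := by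
    rw [injective_iff_map_eq_zero]
    intro u hu
    have huu : localMetric h y x u u = 0 :=
      congrArg (fun L : EuclideanSpace ℝ (Fin n) →L[ℝ] ℝ => L u) hu
    rw [localMetric_apply, inner_self_eq_zero_iff] at huu
    rw [← coframe_frame ((extChartAt (𝓡 n) y).map_target hx) u, huu, map_zero]
  have hfin : Module.finrank ℝ (EuclideanSpace ℝ (Fin n)) =
      Module.finrank ℝ (EuclideanSpace ℝ (Fin n) →L[ℝ] ℝ) := by
    rw [← (LinearMap.toContinuousLinearMap (𝕜 := ℝ) (E := EuclideanSpace ℝ (Fin n))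
      (F' := ℝ)).finrank_eq]
    exact Subspace.dual_finrank_eq.symm
  exact ⟨(LinearEquiv.ofInjectiveOfFinrankEq _ hinj hfin).toContinuousLinearEquiv, rfl⟩

end LocalMetric

/-! ### The Levi-Civita connection and its pull-back -/

section LeviCivita

variable {n : ℕ} {N : Type*} [TopologicalSpace N] [ChartedSpace (EuclideanSpace ℝ (Fin n)) N]
  [IsManifold (𝓡 n) ∞ N] (h : Metric n N)

/-- The Christoffel symbols of `h` in the chart at `y`. -/
abbrev localChristoffel (y : N) (x : EuclideanSpace ℝ (Fin n)) :
    EuclideanSpace ℝ (Fin n) →L[ℝ] EuclideanSpace ℝ (Fin n) →L[ℝ] EuclideanSpace ℝ (Fin n) :=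
  christoffelForm (localMetric h y) x

variable {h} {y z : N}

theorem differentiableAt_localMetric (hz : z ∈ (extChartAt (𝓡 n) y).source) :
    DifferentiableAt ℝ (localMetric h y) (extChartAt (𝓡 n) y z) :=
  (contDiffAt_localMetric ((extChartAt (𝓡 n) y).map_source hz)).differentiableAt (by simp)

theorem dirDeriv_inner_frame (hz : z ∈ (extChartAt (𝓡 n) y).source)
    (u v w : EuclideanSpace ℝ (Fin n)) :
    dirDeriv (fun r => h.inner r (frame y r v) (frame y r w)) z (frame y z u) =
      fderiv ℝ (localMetric h y) (extChartAt (𝓡 n) y z) u v w := by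
  have hsmooth := contMDiffAt_inner (h := h) (φ := fun z : N => z)
    (smoothAt_coordField (v := v) hz) (smoothAt_coordField (v := w) hz)
  rw [← fderiv_clm_apply₂_const (differentiableAt_localMetric hz)]
  exact dirDeriv_frame hz (hsmooth.mdifferentiableAt (by simp)) u

theorem coordField_eq_frame (v : TangentSpace (𝓡 n) y) :
    coordField y v z = frame y z (coframe y y v) :=
  congrArg (frame y z) (coframe_self v).symm

theorem dirDeriv_inner_coordField (u v w : TangentSpace (𝓡 n) y) :
    dirDeriv (fun r => h.inner r (coordField y v r) (coordField y w r)) y u =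
      fderiv ℝ (localMetric h y) (extChartAt (𝓡 n) y y) (coframe y y u) (coframe y y v)
        (coframe y y w) := by
  have hy := mem_extChartAt_source (I := 𝓡 n) y
  rw [← dirDeriv_inner_frame hy, frame_coframe hy]
  simp only [coordField_eq_frame]

theorem coframe_christoffel (v w : TangentSpace (𝓡 n) y) :
    coframe y y (christoffel h y v w) =
      localChristoffel h y (extChartAt (𝓡 n) y y) (coframe y y v) (coframe y y w) := by
  have hy := mem_extChartAt_source (I := 𝓡 n) y
  let K := koszulForm (localMetric h y) (extChartAt (𝓡 n) y y) (coframe y y v) (coframe y y w)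
  have hsharp : christoffel h y v w =
      sharp h y fun z => (K.toLinearMap.comp (coframe y y).toLinearMap) z := by
    simp only [christoffel, dirDeriv_inner_coordField]
    rfl
  rw [← coframe_frame hy (localChristoffel h y _ _ _)]
  refine congrArg (coframe y y) (eq_of_inner_eq (g := h) fun z => ?_)
  rw [hsharp, inner_sharp, inner_eq_localMetric hy, coframe_frame hy,
    apply_christoffelForm (isInvertible_localMetric ((extChartAt (𝓡 n) y).map_source hy))]
  rfl

theorem localChristoffel_symm (hz : z ∈ (extChartAt (𝓡 n) y).source)
    (u v : EuclideanSpace ℝ (Fin n)) :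
    localChristoffel h y (extChartAt (𝓡 n) y z) u v =
      localChristoffel h y (extChartAt (𝓡 n) y z) v u :=
  christoffelForm_symm (differentiableAt_localMetric hz) (fun _ _ _ => localMetric_symm _ _ _) _ _

theorem contDiffAt_localChristoffel (hz : z ∈ (extChartAt (𝓡 n) y).source) :
    ContDiffAt ℝ ∞ (localChristoffel h y) (extChartAt (𝓡 n) y z) :=
  contDiffAt_christoffelForm (contDiffAt_localMetric ((extChartAt (𝓡 n) y).map_source hz))
    (isInvertible_localMetric ((extChartAt (𝓡 n) y).map_source hz))

theorem differentiableAt_localChristoffel (hz : z ∈ (extChartAt (𝓡 n) y).source) :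
    DifferentiableAt ℝ (localChristoffel h y) (extChartAt (𝓡 n) y z) :=
  (contDiffAt_localChristoffel hz).differentiableAt (by simp)

theorem fderiv_localMetric (hz : z ∈ (extChartAt (𝓡 n) y).source)
    (a b c : EuclideanSpace ℝ (Fin n)) :
    fderiv ℝ (localMetric h y) (extChartAt (𝓡 n) y z) a b c =
      localMetric h y (extChartAt (𝓡 n) y z) (localChristoffel h y (extChartAt (𝓡 n) y z) a b) c +
      localMetric h y (extChartAt (𝓡 n) y z) b
        (localChristoffel h y (extChartAt (𝓡 n) y z) a c) :=
  fderiv_eq_christoffelForm (differentiableAt_localMetric hz) (fun _ _ _ => localMetric_symm _ _ _)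
    (isInvertible_localMetric ((extChartAt (𝓡 n) y).map_source hz)) a b c

end LeviCivita

section Along

variable {m n : ℕ}
  {M : Type*} [TopologicalSpace M] [ChartedSpace (EuclideanSpace ℝ (Fin m)) M]
  {N : Type*} [TopologicalSpace N] [ChartedSpace (EuclideanSpace ℝ (Fin n)) N]
  [IsManifold (𝓡 n) ∞ N] {h : Metric n N} {φ : M → N} {p q : M} {y : N}
  {V W : Π q : M, TangentSpace (𝓡 n) (φ q)}

theorem SmoothAt.mdifferentiableAt (hV : SmoothAt m φ V q) :
    MDifferentiableAt (𝓡 m) (𝓡 n) φ q := hV.base.mdifferentiableAt (by simp)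

theorem eventually_chart {P : M → Prop} (hq : q ∈ (extChartAt (𝓡 m) p).source)
    (hP : ∀ᶠ r in 𝓝 q, P r) :
    ∀ᶠ x in 𝓝 (extChartAt (𝓡 m) p q), x ∈ (extChartAt (𝓡 m) p).target ∧
      (extChartAt (𝓡 m) p).symm x ∈ (extChartAt (𝓡 m) p).source ∧
      P ((extChartAt (𝓡 m) p).symm x) := by
  have htarget := eventually_mem_target hq
  have hsymm : Tendsto (extChartAt (𝓡 m) p).symm (𝓝 (extChartAt (𝓡 m) p q)) (𝓝 q) := by
    have := ((continuousOn_extChartAt_symm (I := 𝓡 m) p).continuousAt htarget).tendsto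
    rwa [(extChartAt (𝓡 m) p).left_inv hq] at this
  filter_upwards [htarget, hsymm.eventually hP] with x hx hPx
  exact ⟨hx, (extChartAt (𝓡 m) p).map_target hx, hPx⟩

theorem SmoothAt.smul {f : M → ℝ} (hV : SmoothAt m φ V q)
    (hf : ContMDiffAt (𝓡 m) 𝓘(ℝ, ℝ) ∞ f q) :
    SmoothAt m φ (fun r => f r • V r) q := by
  rw [smoothAt_iff_of_mem (mem_extChartAt_source (I := 𝓡 n) (φ q))] at hV ⊢
  simp only [map_smul]
  exact ⟨hV.1, hf.smul hV.2⟩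

theorem covAlong_comp {Z : Π z : N, TangentSpace (𝓡 n) z} (hφ : MDifferentiableAt (𝓡 m) (𝓡 n) φ q)
    (hZ : SmoothAt n (fun z : N => z) Z (φ q)) (v : TangentSpace (𝓡 m) q) :
    covAlong h φ (fun r => Z (φ r)) q v = nabla h Z (φ q) (differential φ q v) := by
  have hy := mem_extChartAt_source (I := 𝓡 n) (φ q)
  have hcoeff : MDifferentiableAt (𝓡 n) 𝓘(ℝ, EuclideanSpace ℝ (Fin n))
      (coeffAlong (fun z : N => z) Z (φ q)) (φ q) := by
    refine (((smoothAt_iff_of_mem (φ := fun z : N => z) hy).1 hZ).2.mdifferentiableAt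
      (by simp)).congr_of_eventuallyEq ?_
    filter_upwards [eventually_mem_source continuousAt_id hy] with r hr
    exact trivializationAt_snd hr _
  rw [nabla, covAlong, covAlong, differential_id]
  exact congrArg (· + christoffel h (φ q) (differential φ q v) (Z (φ q)))
    (dirDeriv_comp hcoeff hφ v)

theorem localSection_frame_comp (hφ : ContMDiffAt (𝓡 m) (𝓡 n) ∞ φ q)
    (hq : q ∈ (extChartAt (𝓡 m) p).source) (hy : φ q ∈ (extChartAt (𝓡 n) y).source)
    (c : EuclideanSpace ℝ (Fin n)) :
    localSection m φ (fun r => frame y (φ r) c) p y =ᶠ[𝓝 (extChartAt (𝓡 m) p q)] fun _ => c := by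
  filter_upwards [eventually_chart hq (eventually_mem_source hφ.continuousAt hy)] with x hx
  exact coframe_frame hx.2.2 c

variable [IsManifold (𝓡 m) ∞ M]

theorem frameDeriv_frame (hV : SmoothAt m φ V q) (hq : q ∈ (extChartAt (𝓡 m) p).source)
    (u : EuclideanSpace ℝ (Fin m)) :
    frameDeriv φ V q (frame p q u) =
      fderiv ℝ (localSection m φ V p (φ q)) (extChartAt (𝓡 m) p q) u := by
  have hy := mem_extChartAt_source (I := 𝓡 n) (φ q)
  refine (dirDeriv_congr (F := EuclideanSpace ℝ (Fin n)) (f := coeffAlong φ V q) ?_ _).trans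
    (dirDeriv_frame hq (((smoothAt_iff_of_mem hy).1 hV).2.mdifferentiableAt (by simp)) u)
  filter_upwards [eventually_mem_source hV.base.continuousAt hy] with r hr
  exact trivializationAt_snd hr _

variable (m h) in
/-- The pull-back connection applied to a section along `φ`, read in the charts at `p` and `y`. -/
abbrev localCovDeriv (φ : M → N) (V : Π q : M, TangentSpace (𝓡 n) (φ q)) (p : M) (y : N)
    (x : EuclideanSpace ℝ (Fin m)) : EuclideanSpace ℝ (Fin m) →L[ℝ] EuclideanSpace ℝ (Fin n) :=
  covDerivForm (localChristoffel h y) (localMap m n φ p y) (localSection m φ V p y) x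

theorem coframe_covAlong_self (hV : SmoothAt m φ V q) (hq : q ∈ (extChartAt (𝓡 m) p).source)
    (u : EuclideanSpace ℝ (Fin m)) :
    coframe (φ q) (φ q) (covAlong h φ V q (frame p q u)) =
      localCovDeriv m h φ V p (φ q) (extChartAt (𝓡 m) p q) u := by
  have hy := mem_extChartAt_source (I := 𝓡 n) (φ q)
  rw [covAlong, map_add, coframe_christoffel, coframe_differential hq hy hV.mdifferentiableAt,
    covDerivForm_apply, localMap_apply hq, localSection_apply hq, ← frameDeriv_frame hV hq,
    coframe_self]

theorem dirDeriv_inner_localCovDeriv (hV : SmoothAt m φ V q) (hW : SmoothAt m φ W q)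
    (hq : q ∈ (extChartAt (𝓡 m) p).source) (hy : φ q ∈ (extChartAt (𝓡 n) y).source)
    (u : EuclideanSpace ℝ (Fin m)) :
    dirDeriv (fun r => h.inner (φ r) (V r) (W r)) q (frame p q u) =
      localMetric h y (extChartAt (𝓡 n) y (φ q))
        (localCovDeriv m h φ V p y (extChartAt (𝓡 m) p q) u) (coframe y (φ q) (W q)) +
      localMetric h y (extChartAt (𝓡 n) y (φ q)) (coframe y (φ q) (V q))
        (localCovDeriv m h φ W p y (extChartAt (𝓡 m) p q) u) := by
  have hlocal : localFun m (fun r => h.inner (φ r) (V r) (W r)) p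
      =ᶠ[𝓝 (extChartAt (𝓡 m) p q)] fun x => localMetric h y (localMap m n φ p y x)
        (localSection m φ V p y x) (localSection m φ W p y x) := by
    filter_upwards [eventually_chart hq (eventually_mem_source hV.base.continuousAt hy)]
      with x hx
    exact inner_eq_localMetric hx.2.2 _ _
  have hmap := localMap_apply (n := n) (φ := φ) (y := y) hq
  rw [dirDeriv_frame hq ((contMDiffAt_inner hV hW).mdifferentiableAt (by simp)),
    hlocal.fderiv_eq, fderiv_apply_covDerivForm (Γ := localChristoffel h y)
      (hmap ▸ differentiableAt_localMetric hy)
      ((contDiffAt_localMap le_rfl hq hy hV.base).differentiableAt (by simp))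
      ((hV.contDiffAt hq hy).differentiableAt (by simp))
      ((hW.contDiffAt hq hy).differentiableAt (by simp))
      (hmap ▸ fderiv_localMetric hy),
    hmap, localSection_apply hq, localSection_apply hq]

theorem dirDeriv_inner (hV : SmoothAt m φ V q) (hW : SmoothAt m φ W q)
    (v : TangentSpace (𝓡 m) q) :
    dirDeriv (fun r => h.inner (φ r) (V r) (W r)) q v =
      h.inner (φ q) (covAlong h φ V q v) (W q) + h.inner (φ q) (V q) (covAlong h φ W q v) := by
  have hq := mem_extChartAt_source (I := 𝓡 m) q
  have hy := mem_extChartAt_source (I := 𝓡 n) (φ q)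
  rw [← frame_coframe hq v, dirDeriv_inner_localCovDeriv hV hW hq hy, inner_eq_localMetric hy,
    inner_eq_localMetric hy, coframe_covAlong_self hV hq, coframe_covAlong_self hW hq]

theorem localSection_differential (hφ : ContMDiff (𝓡 m) (𝓡 n) ∞ φ)
    {Y : Π r : M, TangentSpace (𝓡 m) r} (hq : q ∈ (extChartAt (𝓡 m) p).source)
    (hy : φ q ∈ (extChartAt (𝓡 n) y).source) :
    localSection m φ (fun r => differential φ r (Y r)) p y =ᶠ[𝓝 (extChartAt (𝓡 m) p q)]
      fun x => fderiv ℝ (localMap m n φ p y) x (localSection m (fun r : M => r) Y p p x) := by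
  filter_upwards [eventually_chart hq (eventually_mem_source hφ.continuous.continuousAt hy)]
    with x hx
  have hcoord := coframe_differential (φ := φ) hx.2.1 hx.2.2
    (hφ.contMDiffAt.mdifferentiableAt (by simp))
    (coframe p _ (Y ((extChartAt (𝓡 m) p).symm x)))
  rwa [frame_coframe hx.2.1, (extChartAt (𝓡 m) p).right_inv hx.1] at hcoord

theorem SmoothAt.map {Y : Π r : M, TangentSpace (𝓡 m) r}
    (hY : SmoothAt m (fun r : M => r) Y q) (hφ : ContMDiff (𝓡 m) (𝓡 n) ∞ φ) :
    SmoothAt m φ (fun r => differential (n := n) φ r (Y r)) q := by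
  have hq := mem_extChartAt_source (I := 𝓡 m) q
  have hy := mem_extChartAt_source (I := 𝓡 n) (φ q)
  refine smoothAt_of_contDiffAt hφ.contMDiffAt hq hy
    (ContDiffAt.congr_of_eventuallyEq ?_ (localSection_differential hφ hq hy))
  exact ((contDiffAt_localMap le_rfl hq hy hφ.contMDiffAt).fderiv_right (m := ∞)
    (by simp)).clm_apply (hY.contDiffAt hq hq)

variable (m n) in
/-- The image under `dφ` of the coordinate field with coefficients `u` of the chart at `p`. -/
def pushField (φ : M → N) (p : M) (u : EuclideanSpace ℝ (Fin m)) (r : M) :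
    TangentSpace (𝓡 n) (φ r) :=
  differential φ r (frame p r u)

theorem localSection_pushField (hφ : ContMDiff (𝓡 m) (𝓡 n) ∞ φ)
    (hq : q ∈ (extChartAt (𝓡 m) p).source) (hy : φ q ∈ (extChartAt (𝓡 n) y).source)
    (u : EuclideanSpace ℝ (Fin m)) :
    localSection m φ (pushField m n φ p u) p y =ᶠ[𝓝 (extChartAt (𝓡 m) p q)]
      fun x => fderiv ℝ (localMap m n φ p y) x u := by
  filter_upwards [localSection_differential (Y := fun r => frame p r u) hφ hq hy,
    localSection_frame_comp (φ := fun r : M => r) contMDiffAt_id hq hq u] with x hx hu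
  exact hx.trans (congrArg _ hu)

theorem smoothAt_pushField (hφ : ContMDiff (𝓡 m) (𝓡 n) ∞ φ)
    (hq : q ∈ (extChartAt (𝓡 m) p).source) (u : EuclideanSpace ℝ (Fin m)) :
    SmoothAt m φ (pushField m n φ p u) q :=
  SmoothAt.map (smoothAt_coordField (v := u) hq) hφ

theorem covAlong_pushField_comm (hφ : ContMDiff (𝓡 m) (𝓡 n) ∞ φ)
    (hq : q ∈ (extChartAt (𝓡 m) p).source) (u v : EuclideanSpace ℝ (Fin m)) :
    covAlong h φ (pushField m n φ p u) q (frame p q v) =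
      covAlong h φ (pushField m n φ p v) q (frame p q u) := by
  have hy := mem_extChartAt_source (I := 𝓡 n) (φ q)
  have hψ : ContDiffAt ℝ 2 (localMap m n φ p (φ q)) (extChartAt (𝓡 m) p q) :=
    (contDiffAt_localMap le_rfl hq hy hφ.contMDiffAt).of_le (by norm_cast)
  have hcov : ∀ u v, coframe (φ q) (φ q) (covAlong h φ (pushField m n φ p u) q (frame p q v)) =
      covDerivForm (localChristoffel h (φ q)) (localMap m n φ p (φ q))
        (fun x => fderiv ℝ (localMap m n φ p (φ q)) x u) (extChartAt (𝓡 m) p q) v := fun u v => by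
    rw [coframe_covAlong_self (smoothAt_pushField hφ hq u) hq, localCovDeriv,
      covDerivForm_congr .rfl (localSection_pushField hφ hq hy u)]
  rw [← frame_coframe hy (covAlong h φ (pushField m n φ p u) q (frame p q v)), hcov,
    covDerivForm_fderiv_comm (localMap_apply (n := n) (φ := φ) hq ▸ localChristoffel_symm hy) hψ,
    ← hcov, frame_coframe hy]

theorem inner_covAlong_pushField (hφ : ContMDiff (𝓡 m) (𝓡 n) ∞ φ)
    (hq : q ∈ (extChartAt (𝓡 m) p).source) (u v w : EuclideanSpace ℝ (Fin m)) :
    h.inner (φ q) (covAlong h φ (pushField m n φ p v) q (frame p q u)) (pushField m n φ p w q) =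
      (1 / 2 : ℝ) *
      (dirDeriv (fun r => h.inner (φ r) (pushField m n φ p v r) (pushField m n φ p w r)) q
          (frame p q u) +
        dirDeriv (fun r => h.inner (φ r) (pushField m n φ p u r) (pushField m n φ p w r)) q
          (frame p q v) -
        dirDeriv (fun r => h.inner (φ r) (pushField m n φ p u r) (pushField m n φ p v r)) q
          (frame p q w)) := by
  have hs := fun u => smoothAt_pushField hφ hq u
  rw [dirDeriv_inner (hs v) (hs w), dirDeriv_inner (hs u) (hs w),
    dirDeriv_inner (hs u) (hs v), covAlong_pushField_comm hφ hq w v,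
    covAlong_pushField_comm hφ hq w u, covAlong_pushField_comm hφ hq u v,
    h.symm _ (pushField m n φ p v q) (covAlong h φ _ q _),
    h.symm _ (pushField m n φ p u q) (covAlong h φ _ q _)]
  ring

theorem pushField_id (u : EuclideanSpace ℝ (Fin m)) :
    pushField m m (fun r : M => r) p u = fun r => frame p r u := funext fun _ => differential_id _

theorem inner_nabla_frame {g : Metric m M} (hq : q ∈ (extChartAt (𝓡 m) p).source)
    (u v w : EuclideanSpace ℝ (Fin m)) :
    g.inner q (nabla g (fun r => frame p r v) q (frame p q u)) (frame p q w) =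
      koszulForm (localMetric g p) (extChartAt (𝓡 m) p q) u v w := by
  have hkoszul := inner_covAlong_pushField (h := g) (φ := fun r : M => r) contMDiff_id hq u v w
  simp only [pushField_id, dirDeriv_inner_frame hq] at hkoszul
  exact hkoszul

theorem smoothAt_frame_comp (hφ : ContMDiffAt (𝓡 m) (𝓡 n) ∞ φ q)
    (hy : φ q ∈ (extChartAt (𝓡 n) y).source) (c : EuclideanSpace ℝ (Fin n)) :
    SmoothAt m φ (fun r => frame y (φ r) c) q :=
  have hq := mem_extChartAt_source (I := 𝓡 m) q
  smoothAt_of_contDiffAt hφ hq hy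
    (contDiffAt_const.congr_of_eventuallyEq (localSection_frame_comp hφ hq hy c))

theorem inner_covAlong_frame_comp (hy : φ q ∈ (extChartAt (𝓡 n) y).source)
    (hq : q ∈ (extChartAt (𝓡 m) p).source) (hφ : ContMDiffAt (𝓡 m) (𝓡 n) ∞ φ q)
    (w : TangentSpace (𝓡 n) (φ q)) (u : EuclideanSpace ℝ (Fin m)) (c : EuclideanSpace ℝ (Fin n)) :
    h.inner (φ q) w (covAlong h φ (fun r => frame y (φ r) c) q (frame p q u)) =
      localMetric h y (extChartAt (𝓡 n) y (φ q)) (coframe y (φ q) w)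
        (localCovDeriv m h φ (fun r => frame y (φ r) c) p y (extChartAt (𝓡 m) p q) u) := by
  have hφd := hφ.mdifferentiableAt (n := ∞) (by simp)
  rw [covAlong_comp (Z := fun z => frame y z c) hφd (smoothAt_coordField (v := c) hy), h.symm,
    ← frame_coframe hy w, ← frame_coframe hy (differential φ q (frame p q u)),
    coframe_differential hq hy hφd, inner_nabla_frame hy, coframe_frame hy, localMetric_symm,
    localCovDeriv, covDerivForm_congr .rfl (localSection_frame_comp hφ hq hy c), covDerivForm_apply,
    fderiv_const_apply, _root_.zero_apply, zero_add, localMap_apply hq, apply_christoffelForm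
      (isInvertible_localMetric ((extChartAt (𝓡 n) y).map_source hy))]

/-- Compatibility with the metric determines `∇V` from `∇W`, for `W` in the coordinate frame at `y`,
and the latter is given by the Koszul formula in every chart. This avoids the transformation law of
the Christoffel symbols. -/
theorem coframe_covAlong (hV : SmoothAt m φ V q) (hq : q ∈ (extChartAt (𝓡 m) p).source)
    (hy : φ q ∈ (extChartAt (𝓡 n) y).source) (u : EuclideanSpace ℝ (Fin m)) :
    coframe y (φ q) (covAlong h φ V q (frame p q u)) =
      localCovDeriv m h φ V p y (extChartAt (𝓡 m) p q) u := by
  rw [← coframe_frame hy (localCovDeriv m h φ V p y _ u)]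
  refine congrArg (coframe y (φ q)) (eq_of_inner_eq (g := h) fun z => ?_)
  rw [← frame_coframe hy z]
  set c := coframe y (φ q) z
  have hW := smoothAt_frame_comp hV.base hy c
  have hcompat := dirDeriv_inner_localCovDeriv (h := h) hV hW hq hy u
  rw [dirDeriv_inner hV hW, inner_covAlong_frame_comp hy hq hV.base,
    add_left_inj] at hcompat
  rw [hcompat, inner_eq_localMetric hy, coframe_frame hy, coframe_frame hy]

end Along

section Curvature

variable {n : ℕ} {N : Type*} [TopologicalSpace N] [ChartedSpace (EuclideanSpace ℝ (Fin n)) N]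
  [IsManifold (𝓡 n) ∞ N] {h : Metric n N} {y z : N}

theorem coframe_injective (hz : z ∈ (extChartAt (𝓡 n) y).source) :
    Function.Injective (coframe (n := n) y z) :=
  Function.LeftInverse.injective (g := frame y z) (frame_coframe hz)

theorem coframe_nabla {Y : Π z : N, TangentSpace (𝓡 n) z}
    (hY : SmoothAt n (fun z : N => z) Y z) (hz : z ∈ (extChartAt (𝓡 n) y).source)
    (u : EuclideanSpace ℝ (Fin n)) :
    coframe y z (nabla h Y z (frame y z u)) =
      covDerivForm (localChristoffel h y) id (localSection n (fun z : N => z) Y y y)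
        (extChartAt (𝓡 n) y z) u := by
  have hid : localMap n n (fun z : N => z) y y =ᶠ[𝓝 (extChartAt (𝓡 n) y z)] id :=
    (eventually_mem_target hz).mono fun x hx => (extChartAt (𝓡 n) y).right_inv hx
  rw [nabla, coframe_covAlong hY hz hz, localCovDeriv, covDerivForm_congr hid .rfl]

theorem coframe_nabla_frame (hz : z ∈ (extChartAt (𝓡 n) y).source)
    (u v : EuclideanSpace ℝ (Fin n)) :
    coframe y z (nabla h (fun z => frame y z v) z (frame y z u)) =
      covDerivForm (localChristoffel h y) id (fun _ => v) (extChartAt (𝓡 n) y z) u := by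
  rw [coframe_nabla (Y := fun z => frame y z v) (smoothAt_coordField (v := v) hz) hz,
    covDerivForm_congr .rfl
      (localSection_frame_comp (φ := fun z : N => z) contMDiffAt_id hz hz v)]

theorem coframe_nabla_nabla_frame (u v w : EuclideanSpace ℝ (Fin n)) :
    coframe y y (nabla h (fun z => nabla h (fun z => frame y z w) z (frame y z v)) y
        (frame y y u)) =
      covDerivForm (localChristoffel h y) id
        (fun x => covDerivForm (localChristoffel h y) id (fun _ => w) x v)
        (extChartAt (𝓡 n) y y) u := by
  have hy := mem_extChartAt_source (I := 𝓡 n) y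
  have hlocal : localSection n (fun z : N => z)
      (fun z => nabla h (fun z => frame y z w) z (frame y z v)) y y =ᶠ[𝓝 (extChartAt (𝓡 n) y y)]
        fun x => covDerivForm (localChristoffel h y) id (fun _ => w) x v := by
    filter_upwards [eventually_mem_target hy] with x hx
    rw [localSection, coframe_nabla_frame ((extChartAt (𝓡 n) y).map_target hx),
      (extChartAt (𝓡 n) y).right_inv hx]
  have hsmooth : ContDiffAt ℝ ∞
      (fun x => covDerivForm (localChristoffel h y) id (fun _ => w) x v)
      (extChartAt (𝓡 n) y y) := by
    simp only [covDerivForm_apply, fderiv_fun_const, fderiv_id, Pi.zero_apply, _root_.zero_apply,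
      zero_add, id, ContinuousLinearMap.id_apply]
    exact ((contDiffAt_localChristoffel hy).clm_apply contDiffAt_const).clm_apply contDiffAt_const
  rw [coframe_nabla (smoothAt_of_contDiffAt contMDiffAt_id hy hy
    (hsmooth.congr_of_eventuallyEq hlocal)) hy, covDerivForm_congr .rfl hlocal]

theorem mpullbackWithin_frame (u : EuclideanSpace ℝ (Fin n)) :
    VectorField.mpullbackWithin 𝓘(ℝ, EuclideanSpace ℝ (Fin n)) (𝓡 n) (extChartAt (𝓡 n) y).symm
      (fun z => frame y z u) (Set.range (𝓡 n)) =ᶠ[𝓝 (extChartAt (𝓡 n) y y)] fun _ => u := by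
  filter_upwards [eventually_mem_target (mem_extChartAt_source y)] with x hx
  have hinv := isInvertible_mfderivWithin_extChartAt_symm (I := 𝓡 n) hx
  rw [modelWithCornersSelf_coe, Set.range_id, mfderivWithin_univ] at hinv
  rw [VectorField.mpullbackWithin_apply, frame_eq_mfderiv ((extChartAt (𝓡 n) y).map_target hx),
    (extChartAt (𝓡 n) y).right_inv hx, modelWithCornersSelf_coe, Set.range_id, mfderivWithin_univ]
  exact hinv.inverse_apply_self _

theorem mlieBracket_frame (u v : EuclideanSpace ℝ (Fin n)) :
    VectorField.mlieBracket (𝓡 n) (fun z => frame y z u) (fun z => frame y z v) y = 0 := by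
  have hconst : VectorField.lieBracket ℝ (fun _ : EuclideanSpace ℝ (Fin n) => u) (fun _ => v)
      (extChartAt (𝓡 n) y y) = 0 := by simp [VectorField.lieBracket_eq]
  have huniv : (extChartAt (𝓡 n) y).symm ⁻¹' Set.univ ∩ Set.range (𝓡 n) = Set.univ := by simp
  rw [VectorField.mlieBracket, VectorField.mlieBracketWithin_apply, huniv]
  refine (congrArg _ ?_).trans (map_zero _)
  exact (congrFun VectorField.lieBracketWithin_univ _).trans
    (((mpullbackWithin_frame u).lieBracket_vectorField_eq (𝕜 := ℝ)
      (mpullbackWithin_frame v)).trans hconst)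

theorem nabla_zero_right {Y : Π z : N, TangentSpace (𝓡 n) z}
    (hY : SmoothAt n (fun z : N => z) Y y) : nabla h Y y 0 = 0 := by
  have hy := mem_extChartAt_source (I := 𝓡 n) y
  apply coframe_injective hy
  rw [← map_zero (frame y y), coframe_nabla hY hy, map_zero, map_zero, map_zero]

theorem coframe_curvature (a b c : TangentSpace (𝓡 n) y) :
    coframe y y (curvature h y a b c) = curvatureForm (localChristoffel h y)
      (extChartAt (𝓡 n) y y) (coframe y y a) (coframe y y b) (coframe y y c) := by
  have hy := mem_extChartAt_source (I := 𝓡 n) y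
  have hfield : ∀ a : TangentSpace (𝓡 n) y,
      coordField y a = fun z => frame y z (coframe y y a) :=
    fun a => funext fun z => coordField_eq_frame a
  have hnabla : ∀ a b c : TangentSpace (𝓡 n) y, coframe y y (nabla h
      (fun z => nabla h (fun z => frame y z (coframe y y c)) z (frame y z (coframe y y b))) y a) =
        covDerivForm (localChristoffel h y) id
          (fun x => covDerivForm (localChristoffel h y) id (fun _ => coframe y y c) x
            (coframe y y b)) (extChartAt (𝓡 n) y y) (coframe y y a) := fun a b c => by
    rw [← coframe_nabla_nabla_frame, frame_coframe hy]
  have hricci := covDerivForm_covDerivForm_sub (Γ := localChristoffel h y) (ψ := id)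
    (ν := fun _ => coframe y y c) (differentiableAt_localChristoffel (h := h) hy)
    contDiffAt_id contDiffAt_const (coframe y y a) (coframe y y b)
  rw [fderiv_id, ← hnabla, ← hnabla] at hricci
  rw [curvature, hfield a, hfield b, hfield c, mlieBracket_frame,
    nabla_zero_right (Y := fun z => frame y z (coframe y y c)) (smoothAt_coordField hy), sub_zero,
    map_sub (coframe y y)]
  exact hricci

theorem inner_curvature_antisymm (a b c d : TangentSpace (𝓡 n) y) :
    h.inner y (curvature h y a b c) d = - h.inner y c (curvature h y a b d) := by
  have hy := mem_extChartAt_source (I := 𝓡 n) y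
  rw [eq_neg_iff_add_eq_zero, inner_eq_localMetric hy, inner_eq_localMetric hy,
    coframe_curvature, coframe_curvature]
  refine curvatureForm_antisymm ((contDiffAt_localMetric
    ((extChartAt (𝓡 n) y).map_source hy)).of_le (by norm_cast))
    (differentiableAt_localChristoffel hy) ?_ _ _ _ _
  filter_upwards [eventually_mem_target hy] with x hx
  rw [← (extChartAt (𝓡 n) y).right_inv hx]
  exact fderiv_localMetric ((extChartAt (𝓡 n) y).map_target hx)

theorem curvature_self (a c : TangentSpace (𝓡 n) y) : curvature h y a a c = 0 := by
  apply coframe_injective (mem_extChartAt_source y)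
  rw [coframe_curvature, curvatureForm, map_zero]
  abel

theorem curvature_add_left (a a' b c : TangentSpace (𝓡 n) y) :
    curvature h y (a + a') b c = curvature h y a b c + curvature h y a' b c := by
  apply coframe_injective (mem_extChartAt_source y)
  simp only [map_add, coframe_curvature, curvatureForm, _root_.add_apply]
  abel

theorem curvature_smul_left (r : ℝ) (a b c : TangentSpace (𝓡 n) y) :
    curvature h y (r • a) b c = r • curvature h y a b c := by
  apply coframe_injective (mem_extChartAt_source y)
  simp only [map_smul, coframe_curvature, curvatureForm, _root_.smul_apply, smul_add, smul_sub]

theorem curvature_add_right (a b c c' : TangentSpace (𝓡 n) y) :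
    curvature h y a b (c + c') = curvature h y a b c + curvature h y a b c' := by
  apply coframe_injective (mem_extChartAt_source y)
  simp only [map_add, coframe_curvature, curvatureForm]
  abel

theorem curvature_smul_right (r : ℝ) (a b c : TangentSpace (𝓡 n) y) :
    curvature h y a b (r • c) = r • curvature h y a b c := by
  apply coframe_injective (mem_extChartAt_source y)
  simp only [map_smul, coframe_curvature, curvatureForm, smul_add, smul_sub]

theorem curvature_zero_middle (a c : TangentSpace (𝓡 n) y) : curvature h y a 0 c = 0 := by
  apply coframe_injective (mem_extChartAt_source y)
  simp [coframe_curvature, curvatureForm]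

end Curvature

/-! ### The second fundamental form -/

section SecondFundamentalForm

variable {m n : ℕ}
  {M : Type*} [TopologicalSpace M] [ChartedSpace (EuclideanSpace ℝ (Fin m)) M]
  [IsManifold (𝓡 m) ∞ M]
  {N : Type*} [TopologicalSpace N] [ChartedSpace (EuclideanSpace ℝ (Fin n)) N]
  [IsManifold (𝓡 n) ∞ N] {g : Metric m M} {h : Metric n N} {φ : M → N} {p q : M} {y : N}
  {V : Π q : M, TangentSpace (𝓡 n) (φ q)}

theorem covAlong_smul {f : M → ℝ} (hf : ContMDiffAt (𝓡 m) 𝓘(ℝ, ℝ) ∞ f q) (hV : SmoothAt m φ V q)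
    (u : TangentSpace (𝓡 m) q) :
    covAlong h φ (fun r => f r • V r) q u = f q • covAlong h φ V q u + dirDeriv f q u • V q := by
  have hq := mem_extChartAt_source (I := 𝓡 m) q
  have hy := mem_extChartAt_source (I := 𝓡 n) (φ q)
  have hlocal : localSection m φ (fun r => f r • V r) q (φ q) =
      fun x => localFun m f q x • localSection m φ V q (φ q) x :=
    funext fun x => map_smul _ _ _
  apply coframe_injective hy
  rw [← frame_coframe hq u, coframe_covAlong (hV.smul hf) hq hy, map_add, map_smul, map_smul,
    coframe_covAlong hV hq hy, dirDeriv_frame hq (hf.mdifferentiableAt (by simp)), localCovDeriv,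
    hlocal, covDerivForm_smul
      (differentiableAt_localFun hq (hf.mdifferentiableAt (by simp)))
      ((hV.contDiffAt hq hy).differentiableAt (by simp)), localFun_apply hq,
    localSection_apply hq]

theorem covAlong_zero_left (hφ : ContMDiffAt (𝓡 m) (𝓡 n) ∞ φ q) (u : TangentSpace (𝓡 m) q) :
    covAlong h φ (fun _ => 0) q u = 0 := by
  have hsmooth := smoothAt_frame_comp hφ (mem_extChartAt_source (I := 𝓡 n) (φ q)) 0
  simpa only [zero_smul, dirDeriv_const, add_zero] using
    covAlong_smul (h := h) (f := fun _ => (0 : ℝ)) contMDiffAt_const hsmooth u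

theorem covAlong_zero_right (hV : SmoothAt m φ V q) :
    covAlong h φ V q (0 : TangentSpace (𝓡 m) q) = 0 := by
  have hq := mem_extChartAt_source (I := 𝓡 m) q
  have hy := mem_extChartAt_source (I := 𝓡 n) (φ q)
  apply coframe_injective hy
  rw [← map_zero (frame q q), coframe_covAlong hV hq hy, map_zero, map_zero]

theorem coframe_secondFundamentalForm (hφ : ContMDiff (𝓡 m) (𝓡 n) ∞ φ)
    (hq : q ∈ (extChartAt (𝓡 m) p).source) (hy : φ q ∈ (extChartAt (𝓡 n) y).source)
    (u v : TangentSpace (𝓡 m) q) :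
    coframe y (φ q) (secondFundamentalForm g h φ q u v) =
      hessianForm (localChristoffel g p) (localChristoffel h y) (localMap m n φ p y)
        (extChartAt (𝓡 m) p q) (coframe p q u) (coframe p q v) := by
  have hφd := hφ.contMDiffAt.mdifferentiableAt (n := ∞) (x := q) (by simp)
  have hY : SmoothAt m (fun r : M => r) (coordField q v) q :=
    smoothAt_coordField (mem_extChartAt_source q)
  rw [← frame_coframe hq u, secondFundamentalForm, map_sub, coframe_covAlong (hY.map hφ) hq hy,
    ← frame_coframe hq (nabla g (coordField q v) q _), coframe_differential hq hy hφd,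
    coframe_nabla hY hq, localCovDeriv,
    covDerivForm_congr .rfl (localSection_differential hφ hq hy),
    covDerivForm_fderiv_sub
      ((contDiffAt_localMap le_rfl hq hy hφ.contMDiffAt).of_le (by norm_cast))
      ((hY.contDiffAt hq hq).differentiableAt (by simp)),
    localSection_apply hq, coordField_self, coframe_frame hq]

variable (g h) in
/-- The second fundamental form of a smooth map as a bilinear map. -/
def secondFundamentalFormₗ (hφ : ContMDiff (𝓡 m) (𝓡 n) ∞ φ) (p : M) :
    TangentSpace (𝓡 m) p →ₗ[ℝ] TangentSpace (𝓡 m) p →ₗ[ℝ] TangentSpace (𝓡 n) (φ p) :=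
  have hp := mem_extChartAt_source (I := 𝓡 m) p
  have hy := mem_extChartAt_source (I := 𝓡 n) (φ p)
  LinearMap.mk₂ ℝ (secondFundamentalForm g h φ p)
    (fun _ _ _ => coframe_injective hy <| by
      simp only [map_add, coframe_secondFundamentalForm hφ hp hy, LinearMap.add_apply])
    (fun _ _ _ => coframe_injective hy <| by
      simp only [map_smul, coframe_secondFundamentalForm hφ hp hy, LinearMap.smul_apply])
    (fun _ _ _ => coframe_injective hy <| by
      simp only [map_add, coframe_secondFundamentalForm hφ hp hy])
    (fun _ _ _ => coframe_injective hy <| by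
      simp only [map_smul, coframe_secondFundamentalForm hφ hp hy])

theorem tension_eq_sum (hφ : ContMDiff (𝓡 m) (𝓡 n) ∞ φ) {ι : Type*} [Fintype ι]
    {b b' : ι → TangentSpace (𝓡 m) p} (hb : IsDualPair g p b b') :
    tension g h φ p = ∑ i, secondFundamentalForm g h φ p (b i) (b' i) :=
  metricTrace_eq_sum hb (secondFundamentalFormₗ g h hφ p)

variable (g p) in
/-- The coefficients `∑ g^{ij} ∂_j` of the frame dual to the coordinate frame of the chart at `p`,
as functions in this chart. -/
def localDualFrame (i : Fin m) (x : EuclideanSpace ℝ (Fin m)) : EuclideanSpace ℝ (Fin m) :=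
  (localMetric g p x).inverse (EuclideanSpace.proj i)

theorem contDiffAt_localDualFrame (hq : q ∈ (extChartAt (𝓡 m) p).source) (i : Fin m) :
    ContDiffAt ℝ ∞ (localDualFrame g p i) (extChartAt (𝓡 m) p q) :=
  have htarget := (extChartAt (𝓡 m) p).map_source hq
  (((isInvertible_localMetric htarget).contDiffAt_map_inverse (n := ∞)).comp _
    (contDiffAt_localMetric (h := g) htarget)).clm_apply contDiffAt_const

theorem isDualPair_frame (hq : q ∈ (extChartAt (𝓡 m) p).source) :
    IsDualPair g q (fun i => frame p q (EuclideanSpace.single i (1 : ℝ)))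
      (fun i : Fin m => frame p q (localDualFrame g p i (extChartAt (𝓡 m) p q))) := by
  intro v
  have hcoeff : ∀ i, g.inner q v (frame p q (localDualFrame g p i (extChartAt (𝓡 m) p q))) =
      coframe p q v i := fun i => by
    rw [inner_eq_localMetric hq, coframe_frame hq, localMetric_symm, localDualFrame,
      (isInvertible_localMetric ((extChartAt (𝓡 m) p).map_source hq)).self_apply_inverse]
    rfl
  have hsum := (EuclideanSpace.basisFun (Fin m) ℝ).sum_repr (coframe p q v)
  simp only [EuclideanSpace.basisFun_repr, EuclideanSpace.basisFun_apply] at hsum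
  simp only [hcoeff, ← map_smul, ← map_sum, hsum, frame_coframe hq]

theorem localSection_tension (hφ : ContMDiff (𝓡 m) (𝓡 n) ∞ φ)
    (hq : q ∈ (extChartAt (𝓡 m) p).source) (hy : φ q ∈ (extChartAt (𝓡 n) y).source) :
    localSection m φ (tension g h φ) p y =ᶠ[𝓝 (extChartAt (𝓡 m) p q)] fun x => ∑ i : Fin m,
      hessianForm (localChristoffel g p) (localChristoffel h y) (localMap m n φ p y) x
        (EuclideanSpace.single i 1) (localDualFrame g p i x) := by
  filter_upwards [eventually_chart hq (eventually_mem_source hφ.continuous.continuousAt hy)]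
    with x hx
  rw [localSection, tension_eq_sum hφ (isDualPair_frame hx.2.1), map_sum]
  refine Finset.sum_congr rfl fun i _ => ?_
  rw [coframe_secondFundamentalForm hφ hx.2.1 hx.2.2, (extChartAt (𝓡 m) p).right_inv hx.1,
    coframe_frame hx.2.1, coframe_frame hx.2.1]

theorem smoothAt_tension (hφ : ContMDiff (𝓡 m) (𝓡 n) ∞ φ) (p : M) :
    SmoothAt m φ (tension g h φ) p := by
  have hp := mem_extChartAt_source (I := 𝓡 m) p
  have hy := mem_extChartAt_source (I := 𝓡 n) (φ p)
  refine smoothAt_of_contDiffAt hφ.contMDiffAt hp hy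
    (ContDiffAt.congr_of_eventuallyEq (ContDiffAt.sum fun i _ => ?_)
      (localSection_tension hφ hp hy))
  exact contDiffAt_hessianForm (contDiffAt_localChristoffel hp)
    (localMap_apply (n := n) (φ := φ) hp ▸ contDiffAt_localChristoffel hy)
    (contDiffAt_localMap le_rfl hp hy hφ.contMDiffAt) contDiffAt_const
    (contDiffAt_localDualFrame hp i)

/-- When `V` is the unit normal of a hypersurface this is the Codazzi equation. -/
theorem curvature_of_covAlong_eq (hφ : ContMDiff (𝓡 m) (𝓡 n) ∞ φ)
    (hV : ∀ᶠ q in 𝓝 p, SmoothAt m φ V q) {k : M → ℝ}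
    (hk : MDifferentiableAt (𝓡 m) 𝓘(ℝ, ℝ) k p)
    (he : ∀ᶠ q in 𝓝 p, ∀ u : TangentSpace (𝓡 m) q,
      covAlong h φ V q u = k q • differential φ q u) (u v : TangentSpace (𝓡 m) p) :
    curvature h (φ p) (differential φ p u) (differential φ p v) (V p) =
      dirDeriv k p u • differential φ p v - dirDeriv k p v • differential φ p u := by
  have hp := mem_extChartAt_source (I := 𝓡 m) p
  have hy := mem_extChartAt_source (I := 𝓡 n) (φ p)
  have hd : ∀ q, MDifferentiableAt (𝓡 m) (𝓡 n) φ q :=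
    fun q => (hφ q).mdifferentiableAt (by simp)
  have hψp := localMap_apply (n := n) (φ := φ) (y := φ p) hp
  have hlocal : ∀ᶠ x in 𝓝 (extChartAt (𝓡 m) p p), ∀ w,
      localCovDeriv m h φ V p (φ p) x w =
        localFun m k p x • fderiv ℝ (localMap m n φ p (φ p)) x w := by
    filter_upwards [eventually_chart hp ((hV.and he).and
      (eventually_mem_source hφ.continuous.continuousAt hy))] with x hx w
    obtain ⟨hx, hq, ⟨hVq, heq⟩, hyq⟩ := hx
    have hcov := coframe_covAlong (h := h) hVq hq hyq w
    rw [heq, map_smul, coframe_differential hq hyq (hd _),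
      (extChartAt (𝓡 m) p).right_inv hx] at hcov
    exact hcov.symm
  apply coframe_injective hy
  rw [← frame_coframe hp u, ← frame_coframe hp v, coframe_curvature, map_sub, map_smul, map_smul,
    coframe_differential hp hy (hd _), coframe_differential hp hy (hd _), dirDeriv_frame hp hk,
    dirDeriv_frame hp hk, ← hψp, ← localSection_apply hp]
  exact curvatureForm_of_covDerivForm_eq (hψp ▸ differentiableAt_localChristoffel hy)
    (hψp ▸ localChristoffel_symm hy)
    ((contDiffAt_localMap le_rfl hp hy hφ.contMDiffAt).of_le (by norm_cast))
    ((hV.self_of_nhds.contDiffAt hp hy).of_le (by norm_cast))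
    (differentiableAt_localFun hp hk) hlocal _ _

end SecondFundamentalForm

/-! ### Isometric immersions -/

section NormalVectors

variable {m n : ℕ} {M : Type*} [TopologicalSpace M] [ChartedSpace (EuclideanSpace ℝ (Fin m)) M]
  {N : Type*} [TopologicalSpace N] [ChartedSpace (EuclideanSpace ℝ (Fin n)) N]

variable (m n) in
/-- The differential of a map as a linear map. -/
def differentialₗ (φ : M → N) (p : M) :
    TangentSpace (𝓡 m) p →ₗ[ℝ] TangentSpace (𝓡 n) (φ p) :=
  (mfderiv (𝓡 m) (𝓡 n) φ p).toLinearMap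

theorem differentialₗ_apply {φ : M → N} {p : M} (v : TangentSpace (𝓡 m) p) :
    differentialₗ m n φ p v = differential φ p v := rfl

variable [IsManifold (𝓡 n) ∞ N] {h : Metric n N} {φ : M → N} {p : M}

variable (m) in
/-- `ν` is normal to `dφ(T_pM)`. -/
def IsNormal (h : Metric n N) (φ : M → N) (p : M) (ν : TangentSpace (𝓡 n) (φ p)) : Prop :=
  ∀ v : TangentSpace (𝓡 m) p, h.inner (φ p) (differential φ p v) ν = 0

variable (h) in
/-- The unit vector in the direction of `w`; it is `0` for `w = 0`. -/
def normalize (y : N) (w : TangentSpace (𝓡 n) y) : TangentSpace (𝓡 n) y :=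
  (√(h.inner y w w))⁻¹ • w

theorem inner_self_nonneg (y : N) (w : TangentSpace (𝓡 n) y) : 0 ≤ h.inner y w w := by
  rcases eq_or_ne w 0 with rfl | hw
  · simp
  · exact (h.pos y w hw).le

theorem inner_self_normalize {y : N} (w : TangentSpace (𝓡 n) y) :
    h.inner y w (normalize h y w) = √(h.inner y w w) := by
  rw [normalize, map_smul, smul_eq_mul, inv_mul_eq_div, Real.div_sqrt]

theorem IsNormal.isUnitNormal_normalize {w : TangentSpace (𝓡 n) (φ p)} (hw : IsNormal m h φ p w)
    (hw0 : w ≠ 0) : IsUnitNormal (m := m) h φ p (normalize h (φ p) w) := by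
  refine ⟨?_, fun v => by rw [normalize, map_smul, hw, smul_zero]⟩
  conv_lhs => enter [1, 2]; rw [normalize]
  rw [map_smul, _root_.smul_apply, inner_self_normalize, smul_eq_mul,
    inv_mul_cancel₀ (Real.sqrt_pos.2 (h.pos _ w hw0)).ne']

end NormalVectors

section Isometric

variable {m n : ℕ}
  {M : Type*} [TopologicalSpace M] [ChartedSpace (EuclideanSpace ℝ (Fin m)) M]
  [IsManifold (𝓡 m) ∞ M]
  {N : Type*} [TopologicalSpace N] [ChartedSpace (EuclideanSpace ℝ (Fin n)) N]
  [IsManifold (𝓡 n) ∞ N] {g : Metric m M} {h : Metric n N} {φ : M → N} {p : M}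
  {V : Π q : M, TangentSpace (𝓡 n) (φ q)}

theorem coordField_eq_fun_frame (v : TangentSpace (𝓡 m) p) :
    coordField p v = fun q => frame p q (coframe p p v) :=
  funext fun _ => coordField_eq_frame v

theorem secondFundamentalForm_eq_pushField (u v : TangentSpace (𝓡 m) p) :
    secondFundamentalForm g h φ p u v =
      covAlong h φ (pushField m n φ p (coframe p p v)) p u -
        differential φ p (nabla g (fun q => frame p q (coframe p p v)) p u) := by
  rw [secondFundamentalForm, coordField_eq_fun_frame]
  rfl

theorem isNormal_secondFundamentalForm (hφ : IsIsometricImmersion g h φ)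
    (u v : TangentSpace (𝓡 m) p) : IsNormal m h φ p (secondFundamentalForm g h φ p u v) := by
  intro w
  have hp := mem_extChartAt_source (I := 𝓡 m) p
  rw [h.symm, ← frame_coframe hp u, ← frame_coframe hp v, ← frame_coframe hp w]
  set a := coframe p p u
  set b := coframe p p v
  set c := coframe p p w
  have hpush := inner_covAlong_pushField (h := h) hφ.1 hp a b c
  simp only [pushField, hφ.2, dirDeriv_inner_frame hp] at hpush
  have hnabla := inner_nabla_frame (g := g) hp a b c
  rw [koszulForm_apply, ← hpush] at hnabla
  rw [secondFundamentalForm_eq_pushField, map_sub, _root_.sub_apply, coframe_frame hp, hφ.2,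
    hnabla]
  exact sub_self _

theorem isNormal_tension (hφ : IsIsometricImmersion g h φ) (p : M) :
    IsNormal m h φ p (tension g h φ p) := by
  intro w
  rw [tension_eq_sum hφ.1 isDualPair_coordBasis, map_sum]
  exact Finset.sum_eq_zero fun i _ => isNormal_secondFundamentalForm hφ _ _ w

theorem inner_covAlong_differential_of_isNormal (hφ : ContMDiff (𝓡 m) (𝓡 n) ∞ φ)
    (hV : SmoothAt m φ V p) (hn : ∀ᶠ q in 𝓝 p, IsNormal m h φ q (V q))
    (u w : TangentSpace (𝓡 m) p) :
    h.inner (φ p) (covAlong h φ V p u) (differential φ p w) =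
      - h.inner (φ p) (V p) (secondFundamentalForm g h φ p u w) := by
  have hp := mem_extChartAt_source (I := 𝓡 m) p
  have hcompat := dirDeriv_inner (h := h) hV (smoothAt_pushField hφ hp (coframe p p w)) u
  have hzero : (fun q => h.inner (φ q) (V q) (pushField m n φ p (coframe p p w) q)) =ᶠ[𝓝 p]
      fun _ => 0 := hn.mono fun q hq => (h.symm _ _ _).trans (hq _)
  rw [dirDeriv_congr hzero, dirDeriv_const, pushField, frame_coframe hp] at hcompat
  rw [secondFundamentalForm_eq_pushField, map_sub, h.symm _ (V p) (differential φ p _),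
    hn.self_of_nhds, sub_zero]
  linarith

theorem inner_shapeOperator (hφ : ContMDiff (𝓡 m) (𝓡 n) ∞ φ) (ν : TangentSpace (𝓡 n) (φ p))
    (u v : TangentSpace (𝓡 m) p) :
    g.inner p (shapeOperator g h φ p ν u) v =
      h.inner (φ p) (secondFundamentalForm g h φ p u v) ν := by
  simp only [shapeOperator, h.symm _ _ ν]
  exact inner_sharp ((h.inner (φ p) ν).toLinearMap.comp (secondFundamentalFormₗ g h hφ p u)) v

theorem meanCurvature_eq (hφ : ContMDiff (𝓡 m) (𝓡 n) ∞ φ) (ν : TangentSpace (𝓡 n) (φ p)) :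
    meanCurvature g h φ p ν = (1 / (m : ℝ)) * h.inner (φ p) (tension g h φ p) ν := by
  simp only [meanCurvature, inner_shapeOperator hφ, tension, metricTrace, map_sum, map_smul,
    _root_.sum_apply, _root_.smul_apply]

/-- The difference of both sides is normal, and orthogonal to every unit normal vector. -/
theorem secondFundamentalForm_eq_of_umbilical (hφ : IsIsometricImmersion g h φ)
    (hM : IsTotallyUmbilical g h φ) (u v : TangentSpace (𝓡 m) p) :
    secondFundamentalForm g h φ p u v =
      ((1 / (m : ℝ)) * g.inner p u v) • tension g h φ p := by
  rw [← sub_eq_zero]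
  set d := secondFundamentalForm g h φ p u v - ((1 / (m : ℝ)) * g.inner p u v) • tension g h φ p
    with hd
  have hnormal : IsNormal m h φ p d := fun w => by
    rw [hd, map_sub, map_smul, isNormal_secondFundamentalForm hφ, isNormal_tension hφ, smul_zero,
      sub_zero]
  have horth : ∀ ν, IsUnitNormal (m := m) h φ p ν → h.inner (φ p) d ν = 0 := fun ν hν => by
    have hshape := inner_shapeOperator (g := g) (h := h) hφ.1 ν u v
    rw [hM p ν hν, meanCurvature_eq hφ.1, map_smul, _root_.smul_apply, smul_eq_mul] at hshape
    rw [hd, map_sub, map_smul, _root_.sub_apply, _root_.smul_apply, ← hshape, smul_eq_mul]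
    ring
  by_contra hd0
  have hsqrt := horth _ (hnormal.isUnitNormal_normalize hd0)
  rw [inner_self_normalize] at hsqrt
  exact (Real.sqrt_pos.2 (h.pos _ d hd0)).ne' hsqrt

end Isometric

/-! ### Totally umbilical hypersurfaces -/

section Hypersurface

variable {m : ℕ}
  {M : Type*} [TopologicalSpace M] [ChartedSpace (EuclideanSpace ℝ (Fin m)) M]
  [IsManifold (𝓡 m) ∞ M]
  {N : Type*} [TopologicalSpace N] [ChartedSpace (EuclideanSpace ℝ (Fin (m + 1))) N]
  [IsManifold (𝓡 (m + 1)) ∞ N] {g : Metric m M} {h : Metric (m + 1) N} {φ : M → N} {p : M}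

theorem exists_eq_differential_add_smul (hφ : IsIsometricImmersion g h φ)
    {ν : TangentSpace (𝓡 (m + 1)) (φ p)} (hν0 : ν ≠ 0) (hν : IsNormal m h φ p ν)
    (w : TangentSpace (𝓡 (m + 1)) (φ p)) :
    ∃ (v : TangentSpace (𝓡 m) p) (t : ℝ), w = differential φ p v + t • ν := by
  let Ψ : EuclideanSpace ℝ (Fin m) × ℝ →ₗ[ℝ] EuclideanSpace ℝ (Fin (m + 1)) :=
    (differentialₗ m (m + 1) φ p).coprod (LinearMap.toSpanSingleton ℝ _ ν)
  have hinj : Function.Injective Ψ := by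
    rw [injective_iff_map_eq_zero]
    rintro ⟨v : TangentSpace (𝓡 m) p, t⟩ hΨ
    have hx : differential φ p v + t • ν = 0 := hΨ
    have ht : t = 0 := by
      have hinner := congrArg (h.inner (φ p) ν) hx
      rw [map_add, map_smul, h.symm _ ν, hν, zero_add, map_zero, smul_eq_mul] at hinner
      exact (mul_eq_zero.1 hinner).resolve_right (h.pos _ ν hν0).ne'
    have hv : g.inner p v v = 0 := by
      rw [ht, zero_smul, add_zero] at hx
      rw [← hφ.2, hx, map_zero]
    exact Prod.ext (inner_self_eq_zero_iff.1 hv) ht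
  have hsurj : Function.Surjective Ψ :=
    (LinearMap.injective_iff_surjective_of_finrank_eq_finrank (by simp)).1 hinj
  obtain ⟨⟨v, t⟩, hx⟩ := hsurj w
  exact ⟨v, t, hx.symm⟩

theorem IsNormal.eq_zero_of_inner_eq_zero {ν w : TangentSpace (𝓡 (m + 1)) (φ p)}
    (hw : IsNormal m h φ p w) (hφ : IsIsometricImmersion g h φ) (hν0 : ν ≠ 0)
    (hν : IsNormal m h φ p ν) (hwν : h.inner (φ p) w ν = 0) : w = 0 := by
  obtain ⟨v, t, hvt⟩ := exists_eq_differential_add_smul hφ hν0 hν w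
  rw [← inner_self_eq_zero_iff (g := h)]
  conv_lhs => enter [2]; rw [hvt]
  rw [map_add, map_smul, h.symm _ w, hw, hwν, smul_zero, add_zero]

theorem IsDualPair.adapted (hφ : IsIsometricImmersion g h φ)
    {ν : TangentSpace (𝓡 (m + 1)) (φ p)} (hν : IsUnitNormal (m := m) h φ p ν)
    {ι : Type*} [Fintype ι] {b b' : ι → TangentSpace (𝓡 m) p} (hb : IsDualPair g p b b') :
    IsDualPair h (φ p) (fun i : Option ι => i.elim ν fun i => differential φ p (b i))
      (fun i : Option ι => i.elim ν fun i => differential φ p (b' i)) := by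
  intro w
  have hν0 : ν ≠ 0 := by
    rintro rfl
    simpa using hν.1
  obtain ⟨v, t, rfl⟩ := exists_eq_differential_add_smul hφ hν0 hν.2 w
  have htangential : ∀ i, h.inner (φ p) (differential φ p v + t • ν) (differential φ p (b' i)) =
      g.inner p v (b' i) := fun i => by
    rw [map_add, map_smul, _root_.add_apply, _root_.smul_apply, h.symm _ ν, hν.2, hφ.2, smul_zero,
      add_zero]
  have hnormal : h.inner (φ p) (differential φ p v + t • ν) ν = t := by
    rw [map_add, map_smul, _root_.add_apply, _root_.smul_apply, hν.2, hν.1, smul_eq_mul, mul_one,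
      zero_add]
  have hsum : ∑ i, g.inner p v (b' i) • differential (n := m + 1) φ p (b i) =
      differential φ p v := by
    simp only [← differentialₗ_apply, ← map_smul, ← map_sum, hb v]
  simp only [Fintype.sum_option, Option.elim_none, Option.elim_some, htangential, hnormal, hsum]
  exact add_comm _ _

theorem covAlong_eq_of_isNormal_of_umbilical (hφ : IsIsometricImmersion g h φ)
    (hM : IsTotallyUmbilical g h φ) {V : Π q : M, TangentSpace (𝓡 (m + 1)) (φ q)}
    (hV : SmoothAt m φ V p) (hV0 : V p ≠ 0) (hn : ∀ᶠ q in 𝓝 p, IsNormal m h φ q (V q))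
    (u : TangentSpace (𝓡 m) p) (hc : dirDeriv (fun q => h.inner (φ q) (V q) (V q)) p u = 0) :
    covAlong h φ V p u =
      (-((1 / (m : ℝ)) * h.inner (φ p) (tension g h φ p) (V p))) • differential φ p u := by
  rw [← sub_eq_zero]
  refine IsNormal.eq_zero_of_inner_eq_zero (fun w => ?_) hφ hV0 hn.self_of_nhds ?_
  · rw [h.symm, map_sub, map_smul, _root_.sub_apply, _root_.smul_apply,
      inner_covAlong_differential_of_isNormal (g := g) hφ.1 hV hn, hφ.2,
      secondFundamentalForm_eq_of_umbilical hφ hM, map_smul, smul_eq_mul, smul_eq_mul,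
      h.symm _ (V p)]
    ring
  · rw [dirDeriv_inner hV hV, h.symm _ (V p)] at hc
    rw [map_sub, map_smul, _root_.sub_apply, _root_.smul_apply, hn.self_of_nhds, smul_zero,
      sub_zero]
    linarith

end Hypersurface

/-! ### Functions on a Riemannian manifold -/

section Functions

variable {m : ℕ} {M : Type*} [TopologicalSpace M] [ChartedSpace (EuclideanSpace ℝ (Fin m)) M]
  {f : M → ℝ} {p : M}

theorem dirDeriv_comp_eq_fderiv {F : ℝ → ℝ} (hF : DifferentiableAt ℝ F (f p))
    (hf : MDifferentiableAt (𝓡 m) 𝓘(ℝ, ℝ) f p) (v : TangentSpace (𝓡 m) p) :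
    dirDeriv (fun q => F (f q)) p v = fderiv ℝ F (f p) (dirDeriv f p v) := by
  have hchain := mfderiv_comp p hF.mdifferentiableAt hf
  rw [mfderiv_eq_fderiv] at hchain
  exact congrArg (fun L : EuclideanSpace ℝ (Fin m) →L[ℝ] ℝ => L v) hchain

variable [IsManifold (𝓡 m) ∞ M]

theorem dirDeriv_eq_zero_of_isLocalMin (hf : MDifferentiableAt (𝓡 m) 𝓘(ℝ, ℝ) f p)
    (hmin : IsLocalMin f p) (v : TangentSpace (𝓡 m) p) : dirDeriv f p v = 0 := by
  have hp := mem_extChartAt_source (I := 𝓡 m) p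
  have hlocal : IsLocalMin (localFun m f p) (extChartAt (𝓡 m) p p) := by
    filter_upwards [eventually_chart hp hmin] with x hx
    rw [localFun_apply hp]
    exact hx.2.2
  rw [← frame_coframe hp v, dirDeriv_frame hp hf, hlocal.fderiv_eq_zero, _root_.zero_apply]

theorem fderiv_localFun_eq_zero (hf : MDifferentiable (𝓡 m) 𝓘(ℝ, ℝ) f)
    (h0 : ∀ (p : M) (v : TangentSpace (𝓡 m) p), dirDeriv f p v = 0)
    {x : EuclideanSpace ℝ (Fin m)} (hx : x ∈ (extChartAt (𝓡 m) p).target) :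
    fderiv ℝ (localFun m f p) x = 0 := by
  ext u
  have hu := dirDeriv_frame ((extChartAt (𝓡 m) p).map_target hx) (hf _) u
  rw [h0, (extChartAt (𝓡 m) p).right_inv hx] at hu
  exact hu.symm

theorem isLocallyConstant_of_dirDeriv_eq_zero (hf : MDifferentiable (𝓡 m) 𝓘(ℝ, ℝ) f)
    (h0 : ∀ (p : M) (v : TangentSpace (𝓡 m) p), dirDeriv f p v = 0) : IsLocallyConstant f := by
  rw [IsLocallyConstant.iff_eventually_eq]
  intro p
  have hp := mem_extChartAt_source (I := 𝓡 m) p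
  have hdiff : DifferentiableOn ℝ (localFun m f p) (extChartAt (𝓡 m) p).target := fun x hx =>
    ((extChartAt (𝓡 m) p).right_inv hx ▸ differentiableAt_localFun
      ((extChartAt (𝓡 m) p).map_target hx) (hf _)).differentiableWithinAt
  obtain ⟨r, hr, hball⟩ := Metric.isOpen_iff.1 (isOpen_extChartAt_target (I := 𝓡 m) p) _
    ((extChartAt (𝓡 m) p).map_source hp)
  filter_upwards [(isOpen_extChartAt_source (I := 𝓡 m) p).mem_nhds hp,
    (continuousAt_extChartAt (I := 𝓡 m) p).preimage_mem_nhds (Metric.ball_mem_nhds _ hr)]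
    with q hq hqball
  rw [← localFun_apply (f := f) hq, ← localFun_apply (f := f) hp]
  exact Metric.isOpen_ball.is_const_of_fderiv_eq_zero (convex_ball _ _).isPreconnected
    (hdiff.mono hball) (fun x hx => fderiv_localFun_eq_zero hf h0 (hball hx)) hqball
    (Metric.mem_ball_self hr)

theorem exists_eq_const_of_dirDeriv_eq_zero [ConnectedSpace M]
    (hf : MDifferentiable (𝓡 m) 𝓘(ℝ, ℝ) f)
    (h0 : ∀ (p : M) (v : TangentSpace (𝓡 m) p), dirDeriv f p v = 0) : ∃ c, f = fun _ => c :=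
  (isLocallyConstant_of_dirDeriv_eq_zero hf h0).exists_eq_const

variable {g : Metric m M}

theorem inner_grad (v : TangentSpace (𝓡 m) p) : g.inner p (grad g f p) v = dirDeriv f p v :=
  inner_sharp (mfderiv (𝓡 m) 𝓘(ℝ, ℝ) f p).toLinearMap v

theorem grad_const (c : ℝ) : grad g (fun _ => c) p = 0 := by
  rw [← inner_self_eq_zero_iff (g := g), inner_grad, dirDeriv_const]

theorem laplacian_const (c : ℝ) : laplacian g (fun _ => c) p = 0 := by
  simp [laplacian, dirDeriv_const, metricTrace]

variable {ι : Type*} [Fintype ι] {b b' : ι → TangentSpace (𝓡 m) p}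

theorem sum_dirDeriv_mul_inner (hb : IsDualPair g p b b') (v : TangentSpace (𝓡 m) p) :
    ∑ i, dirDeriv f p (b i) * g.inner p v (b' i) = dirDeriv f p v := by
  conv_rhs => rw [dirDeriv, ← hb v, map_sum]
  exact Finset.sum_congr rfl fun i _ =>
    (mul_comm _ _).trans (map_smul (mfderiv (𝓡 m) 𝓘(ℝ, ℝ) f p) _ _).symm

theorem ricci_eq_sum (hb : IsDualPair g p b b') (v w : TangentSpace (𝓡 m) p) :
    ricci g p v w = ∑ i, g.inner p (curvature g p (b i) v w) (b' i) :=
  metricTrace_eq_sum hb (LinearMap.mk₂ ℝ (fun u u' => g.inner p (curvature g p u v w) u')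
    (fun _ _ _ => by rw [curvature_add_left, map_add, _root_.add_apply])
    (fun _ _ _ => by rw [curvature_smul_left, map_smul, _root_.smul_apply])
    (fun _ _ _ => map_add _ _ _) (fun _ _ _ => map_smul _ _ _))

theorem inner_curvature_self (a b c : TangentSpace (𝓡 m) p) :
    g.inner p (curvature g p a b c) c = 0 := by
  have hantisymm := inner_curvature_antisymm (h := g) a b c c
  rw [g.symm p c] at hantisymm
  exact self_eq_neg.1 hantisymm

end Functions

section Normalize

variable {m n : ℕ}
  {M : Type*} [TopologicalSpace M] [ChartedSpace (EuclideanSpace ℝ (Fin m)) M]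
  {N : Type*} [TopologicalSpace N] [ChartedSpace (EuclideanSpace ℝ (Fin n)) N]
  [IsManifold (𝓡 n) ∞ N] {h : Metric n N} {φ : M → N} {p : M}
  {V : Π q : M, TangentSpace (𝓡 n) (φ q)}

theorem SmoothAt.contMDiffAt_sqrt_inner_self (hV : SmoothAt m φ V p) (hV0 : V p ≠ 0) :
    ContMDiffAt (𝓡 m) 𝓘(ℝ, ℝ) ∞ (fun q => √(h.inner (φ q) (V q) (V q))) p :=
  (Real.contDiffAt_sqrt (h.pos _ _ hV0).ne').contMDiffAt.comp p (contMDiffAt_inner hV hV)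

theorem SmoothAt.normalize (hV : SmoothAt m φ V p) (hV0 : V p ≠ 0) :
    SmoothAt m φ (fun q => normalize h (φ q) (V q)) p :=
  hV.smul ((contDiffAt_inv ℝ (Real.sqrt_pos.2 (h.pos _ _ hV0)).ne').contMDiffAt.comp p
    (hV.contMDiffAt_sqrt_inner_self hV0))

end Normalize

/-! ### The tension field of a totally umbilical hypersurface -/

section Tension

variable {m n : ℕ}
  {M : Type*} [TopologicalSpace M] [ChartedSpace (EuclideanSpace ℝ (Fin m)) M]
  [IsManifold (𝓡 m) ∞ M]
  {N : Type*} [TopologicalSpace N] [ChartedSpace (EuclideanSpace ℝ (Fin n)) N]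
  [IsManifold (𝓡 n) ∞ N] {g : Metric m M} {h : Metric n N} {φ : M → N}

variable (g h φ) in
/-- The squared norm of the tension field. -/
def tensionSq (p : M) : ℝ :=
  h.inner (φ p) (tension g h φ p) (tension g h φ p)

theorem contMDiff_tensionSq (hφ : ContMDiff (𝓡 m) (𝓡 n) ∞ φ) :
    ContMDiff (𝓡 m) 𝓘(ℝ, ℝ) ∞ (tensionSq g h φ) :=
  fun p => contMDiffAt_inner (smoothAt_tension hφ p) (smoothAt_tension hφ p)

theorem tensionSq_eq_zero_iff {p : M} : tensionSq g h φ p = 0 ↔ tension g h φ p = 0 :=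
  inner_self_eq_zero_iff

theorem metricTrace_secondCovDeriv (hφ : ContMDiff (𝓡 m) (𝓡 n) ∞ φ)
    {V : Π q : M, TangentSpace (𝓡 n) (φ q)} {c : ℝ}
    (hV : ∀ (q : M) (u : TangentSpace (𝓡 m) q), covAlong h φ V q u = c • differential φ q u)
    (p : M) : metricTrace g p (secondCovDeriv g h φ V p) = c • tension g h φ p := by
  have hsecond : secondCovDeriv g h φ V p = fun u v => c • secondFundamentalForm g h φ p u v := by
    funext u v
    have hY : SmoothAt m (fun q : M => q) (coordField p v) p :=
      smoothAt_coordField (mem_extChartAt_source p)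
    have hconst := covAlong_smul (h := h) (f := fun _ => c) contMDiffAt_const (hY.map hφ) u
    rw [dirDeriv_const, zero_smul, add_zero] at hconst
    simp only [secondCovDeriv, secondFundamentalForm, hV, smul_sub, hconst]
  simp only [hsecond, tension, metricTrace, Finset.smul_sum, smul_comm c]

theorem metricTrace_curvature_eq_sum {p : M} {ι : Type*} [Fintype ι]
    {b b' : ι → TangentSpace (𝓡 m) p} (hb : IsDualPair g p b b')
    (w : TangentSpace (𝓡 n) (φ p)) :
    metricTrace g p
        (fun u v => curvature h (φ p) (differential φ p u) w (differential φ p v)) =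
      ∑ i, curvature h (φ p) (differential φ p (b i)) w (differential φ p (b' i)) :=
  metricTrace_eq_sum hb (LinearMap.mk₂ ℝ
    (fun u v => curvature h (φ p) (differential φ p u) w (differential φ p v))
    (fun _ _ _ => by simp only [← differentialₗ_apply, map_add, curvature_add_left])
    (fun _ _ _ => by simp only [← differentialₗ_apply, map_smul, curvature_smul_left])
    (fun _ _ _ => by simp only [← differentialₗ_apply, map_add, curvature_add_right])
    (fun _ _ _ => by simp only [← differentialₗ_apply, map_smul, curvature_smul_right]))

theorem IsTotallyGeodesic.tension_eq_zero (hg : IsTotallyGeodesic g h φ) :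
    tension g h φ = fun _ => 0 := by
  funext p
  simp [tension, metricTrace, hg p]

theorem IsBiharmonic.isFBiharmonicSubmanifold (hφ : ContMDiff (𝓡 m) (𝓡 n) ∞ φ)
    (hb : IsBiharmonic g h φ) : IsFBiharmonicSubmanifold g h φ := by
  refine ⟨fun _ => 1, contMDiff_const, fun _ => one_pos, fun p => ?_⟩
  rw [fBitension, hb p, laplacian_const, grad_const, covAlong_zero_right (smoothAt_tension hφ p)]
  simp

theorem grad_eq_zero_of_isFBiharmonicMap (hφ : IsIsometricImmersion g h φ) {c : ℝ} (hc0 : c ≠ 0)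
    (hc : ∀ (q : M) (u : TangentSpace (𝓡 m) q),
      covAlong h φ (tension g h φ) q u = c • differential φ q u)
    {d : ℝ} (hd : ∀ q, bitension g h φ q = d • tension g h φ q)
    {f : M → ℝ} (hf : IsFBiharmonicMap g h φ f) (p : M) : grad g f p = 0 := by
  have htangential := congrArg (h.inner (φ p) (differential φ p (grad g f p))) (hf p)
  simp only [fBitension, hd, hc, map_add, map_smul, isNormal_tension hφ p _, hφ.2, smul_eq_mul,
    mul_zero, zero_add, map_zero] at htangential
  rw [← inner_self_eq_zero_iff (g := g)]
  simpa [hc0] using htangential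

end Tension

section Hypersurface

variable {m : ℕ}
  {M : Type*} [TopologicalSpace M] [ChartedSpace (EuclideanSpace ℝ (Fin m)) M]
  [IsManifold (𝓡 m) ∞ M]
  {N : Type*} [TopologicalSpace N] [ChartedSpace (EuclideanSpace ℝ (Fin (m + 1))) N]
  [IsManifold (𝓡 (m + 1)) ∞ N] {g : Metric m M} {h : Metric (m + 1) N} {φ : M → N} {p : M}
  {lam : ℝ}

theorem sum_inner_curvature_differential (hφ : IsIsometricImmersion g h φ)
    {ν : TangentSpace (𝓡 (m + 1)) (φ p)} (hν : IsUnitNormal (m := m) h φ p ν)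
    {ι : Type*} [Fintype ι] {b b' : ι → TangentSpace (𝓡 m) p} (hb : IsDualPair g p b b')
    (v w : TangentSpace (𝓡 (m + 1)) (φ p)) :
    ∑ i, h.inner (φ p) (curvature h (φ p) (differential φ p (b i)) v w)
      (differential φ p (b' i)) =
    ricci h (φ p) v w - h.inner (φ p) (curvature h (φ p) ν v w) ν := by
  rw [ricci_eq_sum (hb.adapted hφ hν), Fintype.sum_option]
  simp

/-- The trace of the Codazzi equation: in an Einstein space it reads `(m - 1) dk = 0`. -/
theorem dirDeriv_eq_zero_of_isEinstein (hm : 2 ≤ m) (hφ : IsIsometricImmersion g h φ)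
    (hN : IsEinstein h lam) {V : Π q : M, TangentSpace (𝓡 (m + 1)) (φ q)}
    (hV : ∀ᶠ q in 𝓝 p, SmoothAt m φ V q) (hn : IsUnitNormal (m := m) h φ p (V p)) {k : M → ℝ}
    (hk : MDifferentiableAt (𝓡 m) 𝓘(ℝ, ℝ) k p)
    (he : ∀ᶠ q in 𝓝 p, ∀ u : TangentSpace (𝓡 m) q,
      covAlong h φ V q u = k q • differential φ q u) (v : TangentSpace (𝓡 m) p) :
    dirDeriv k p v = 0 := by
  have htrace := sum_inner_curvature_differential hφ hn isDualPair_coordBasis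
    (differential φ p v) (V p)
  simp only [inner_curvature_self, hN (φ p), hn.2, curvature_of_covAlong_eq hφ.1 hV hk he, map_sub,
    map_smul, _root_.sub_apply, _root_.smul_apply, hφ.2, smul_eq_mul, Finset.sum_sub_distrib,
    ← Finset.mul_sum, sum_dirDeriv_mul_inner isDualPair_coordBasis,
    sum_inner_dualPair isDualPair_coordBasis, mul_zero, sub_zero] at htrace
  have hm1 : (m : ℝ) - 1 ≠ 0 := sub_ne_zero.2 (by exact_mod_cast (by omega : m ≠ 1))
  have hmul : dirDeriv k p v * ((m : ℝ) - 1) = 0 := by linarith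
  exact (mul_eq_zero.1 hmul).resolve_right hm1

theorem covAlong_normalize_tension (hφ : IsIsometricImmersion g h φ)
    (hM : IsTotallyUmbilical g h φ) (hp : ∀ᶠ q in 𝓝 p, tension g h φ q ≠ 0)
    (u : TangentSpace (𝓡 m) p) :
    covAlong h φ (fun q => normalize h (φ q) (tension g h φ q)) p u =
      (-((1 / (m : ℝ)) * √(tensionSq g h φ p))) • differential φ p u := by
  have hunit : ∀ᶠ q in 𝓝 p,
      IsUnitNormal (m := m) h φ q (normalize h (φ q) (tension g h φ q)) :=
    hp.mono fun q hq => (isNormal_tension hφ q).isUnitNormal_normalize hq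
  rw [covAlong_eq_of_isNormal_of_umbilical hφ hM
    ((smoothAt_tension hφ.1 p).normalize hp.self_of_nhds) ?_ (hunit.mono fun q hq => hq.2) u ?_,
    inner_self_normalize, tensionSq]
  · intro hzero
    simpa [hzero] using hunit.self_of_nhds.1
  · rw [dirDeriv_congr (f' := fun _ => (1 : ℝ)) (hunit.mono fun q hq => hq.1), dirDeriv_const]

theorem dirDeriv_tensionSq_of_ne_zero (hm : 2 ≤ m) (hφ : IsIsometricImmersion g h φ)
    (hN : IsEinstein h lam) (hM : IsTotallyUmbilical g h φ) (hp : tensionSq g h φ p ≠ 0)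
    (v : TangentSpace (𝓡 m) p) : dirDeriv (tensionSq g h φ) p v = 0 := by
  have hm0 : (m : ℝ) ≠ 0 := by positivity
  have hne : ∀ᶠ q in 𝓝 p, tension g h φ q ≠ 0 :=
    ((contMDiff_tensionSq hφ.1).continuous.continuousAt.eventually_ne hp).mono
      fun q hq => tensionSq_eq_zero_iff.not.1 hq
  let k : M → ℝ := fun q => -((1 / (m : ℝ)) * √(tensionSq g h φ q))
  have hk : MDifferentiableAt (𝓡 m) 𝓘(ℝ, ℝ) k p := by
    have hsqrt : ContMDiffAt (𝓡 m) 𝓘(ℝ, ℝ) ∞ (fun q => √(tensionSq g h φ q)) p :=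
      (smoothAt_tension hφ.1 p).contMDiffAt_sqrt_inner_self hne.self_of_nhds
    exact (contMDiffAt_const.mul hsqrt).neg.mdifferentiableAt (by simp)
  have hk0 : dirDeriv k p v = 0 :=
    dirDeriv_eq_zero_of_isEinstein hm hφ hN
      (hne.mono fun q hq => (smoothAt_tension hφ.1 q).normalize hq)
      ((isNormal_tension hφ p).isUnitNormal_normalize hne.self_of_nhds) hk
      (hne.eventually_nhds.mono fun q hq => covAlong_normalize_tension hφ hM hq) v
  have hsq : tensionSq g h φ = fun q => (m * k q) ^ 2 := by
    funext q
    have hsqrt : √(tensionSq g h φ q) ^ 2 = tensionSq g h φ q :=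
      Real.sq_sqrt (inner_self_nonneg _ _)
    simp only [k]
    field_simp
    exact hsqrt.symm
  rw [hsq, dirDeriv_comp_eq_fderiv (F := fun t => (m * t) ^ 2) (by fun_prop) hk, hk0, map_zero]

theorem exists_tensionSq_eq_const [ConnectedSpace M] (hm : 2 ≤ m)
    (hφ : IsIsometricImmersion g h φ) (hN : IsEinstein h lam) (hM : IsTotallyUmbilical g h φ) :
    ∃ s, tensionSq g h φ = fun _ => s := by
  have hd : MDifferentiable (𝓡 m) 𝓘(ℝ, ℝ) (tensionSq g h φ) :=
    (contMDiff_tensionSq hφ.1).mdifferentiable (by simp)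
  refine exists_eq_const_of_dirDeriv_eq_zero hd fun p v => ?_
  by_cases hp : tensionSq g h φ p = 0
  · exact dirDeriv_eq_zero_of_isLocalMin (hd p)
      (Eventually.of_forall fun q => hp.trans_le (inner_self_nonneg _ _)) v
  · exact dirDeriv_tensionSq_of_ne_zero hm hφ hN hM hp v

theorem covAlong_tension (hφ : IsIsometricImmersion g h φ) (hM : IsTotallyUmbilical g h φ)
    {s : ℝ} (hs : tensionSq g h φ = fun _ => s) (hs0 : s ≠ 0) (p : M) (u : TangentSpace (𝓡 m) p) :
    covAlong h φ (tension g h φ) p u = (-(s / m)) • differential φ p u := by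
  have hsp : h.inner (φ p) (tension g h φ p) (tension g h φ p) = s := congrFun hs p
  rw [covAlong_eq_of_isNormal_of_umbilical hφ hM (smoothAt_tension hφ.1 p) ?_
    (Eventually.of_forall (isNormal_tension hφ)) u ?_, hsp, one_div_mul_eq_div]
  · rwa [Ne, ← tensionSq_eq_zero_iff, hs]
  · exact (congrArg (fun f => dirDeriv f p u) hs).trans (dirDeriv_const _ _)

theorem metricTrace_curvature_tension (hφ : IsIsometricImmersion g h φ) (hN : IsEinstein h lam)
    (p : M) :
    metricTrace g p (fun u v => curvature h (φ p) (differential φ p u) (tension g h φ p)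
      (differential φ p v)) = (-lam) • tension g h φ p := by
  rw [metricTrace_curvature_eq_sum isDualPair_coordBasis]
  rcases eq_or_ne (tension g h φ p) 0 with hp | hp
  · rw [hp, smul_zero]
    exact Finset.sum_eq_zero fun i _ => curvature_zero_middle _ _
  refine eq_of_inner_eq (g := h) fun w => ?_
  have hricci := sum_inner_curvature_differential hφ
    ((isNormal_tension hφ p).isUnitNormal_normalize hp) isDualPair_coordBasis
    (tension g h φ p) w
  rw [normalize, curvature_smul_left, curvature_self, smul_zero, map_zero, _root_.zero_apply,
    sub_zero] at hricci
  rw [map_sum, _root_.sum_apply, map_smul, _root_.smul_apply, smul_eq_mul, neg_mul, ← hN,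
    ← hricci, ← Finset.sum_neg_distrib]
  exact Finset.sum_congr rfl fun i _ => by rw [inner_curvature_antisymm, h.symm]

theorem bitension_eq (hφ : IsIsometricImmersion g h φ) (hN : IsEinstein h lam) {c : ℝ}
    (hc : ∀ (q : M) (u : TangentSpace (𝓡 m) q),
      covAlong h φ (tension g h φ) q u = c • differential φ q u) (p : M) :
    bitension g h φ p = (c + lam) • tension g h φ p := by
  rw [bitension, metricTrace_secondCovDeriv hφ.1 hc, metricTrace_curvature_tension hφ hN,
    ← sub_smul, sub_neg_eq_add]

theorem IsTotallyGeodesic.isBiharmonic (hg : IsTotallyGeodesic g h φ)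
    (hφ : IsIsometricImmersion g h φ) (hN : IsEinstein h lam) : IsBiharmonic g h φ := by
  have hcov : ∀ (q : M) (u : TangentSpace (𝓡 m) q),
      covAlong h φ (tension g h φ) q u = (0 : ℝ) • differential φ q u := fun q u => by
    rw [hg.tension_eq_zero, covAlong_zero_left hφ.1.contMDiffAt, zero_smul]
  intro p
  rw [bitension_eq hφ hN hcov, hg.tension_eq_zero, smul_zero]

theorem isTotallyGeodesic_of_tensionSq_eq_zero (hφ : IsIsometricImmersion g h φ)
    (hM : IsTotallyUmbilical g h φ) (h0 : tensionSq g h φ = fun _ => 0) :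
    IsTotallyGeodesic g h φ := fun p u v => by
  rw [secondFundamentalForm_eq_of_umbilical hφ hM, tensionSq_eq_zero_iff.1 (congrFun h0 p),
    smul_zero]

theorem IsFBiharmonicSubmanifold.eq_of_tensionSq_eq_const [ConnectedSpace M] (hm : m ≠ 0)
    (hf : IsFBiharmonicSubmanifold g h φ) (hφ : IsIsometricImmersion g h φ)
    (hN : IsEinstein h lam) (hM : IsTotallyUmbilical g h φ) {s : ℝ}
    (hs : tensionSq g h φ = fun _ => s) (hs0 : s ≠ 0) : lam = s / m := by
  obtain ⟨f, hfs, hfpos, hf⟩ := hf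
  have hcov := covAlong_tension hφ hM hs hs0
  have hbi := bitension_eq hφ hN hcov
  have hc0 : -(s / m) ≠ 0 := neg_ne_zero.2 (div_ne_zero hs0 (Nat.cast_ne_zero.2 hm))
  have hgrad := grad_eq_zero_of_isFBiharmonicMap hφ hc0 hcov hbi hf
  obtain ⟨c, rfl⟩ := exists_eq_const_of_dirDeriv_eq_zero (hfs.mdifferentiable (by simp))
    fun p v => by rw [← inner_grad (g := g), hgrad, map_zero, _root_.zero_apply]
  obtain ⟨p⟩ := (inferInstance : Nonempty M)
  have hnormal := hf p
  rw [fBitension, hgrad, covAlong_zero_right (smoothAt_tension hφ.1 p), laplacian_const, hbi,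
    zero_smul, smul_zero, add_zero, add_zero, smul_smul] at hnormal
  have hne : tension g h φ p ≠ 0 := tensionSq_eq_zero_iff.not.1 (by rwa [hs])
  have hsum := (mul_eq_zero.1 ((smul_eq_zero.1 hnormal).resolve_right hne)).resolve_left
    (hfpos p).ne'
  linarith

theorem isBiharmonic_of_tensionSq_eq (hφ : IsIsometricImmersion g h φ)
    (hN : IsEinstein h lam) (hM : IsTotallyUmbilical g h φ) {s : ℝ}
    (hs : tensionSq g h φ = fun _ => s) (hs0 : s ≠ 0) (hlam : lam = s / m) :
    IsBiharmonic g h φ := fun p => by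
  rw [bitension_eq hφ hN (covAlong_tension hφ hM hs hs0), hlam, neg_add_cancel, zero_smul]

theorem hasConstantMeanCurvature_of_tensionSq_eq (hφ : IsIsometricImmersion g h φ) {s : ℝ}
    (hs : tensionSq g h φ = fun _ => s) (hs0 : s ≠ 0) :
    HasConstantMeanCurvature g h φ (√s / m) := by
  have hne : ∀ p, tension g h φ p ≠ 0 := fun p => tensionSq_eq_zero_iff.not.1 (by rwa [hs])
  refine ⟨fun p => normalize h (φ p) (tension g h φ p),
    fun p => (smoothAt_tension hφ.1 p).normalize (hne p),
    fun p => (isNormal_tension hφ p).isUnitNormal_normalize (hne p), fun p => ?_⟩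
  rw [meanCurvature_eq hφ.1, inner_self_normalize, one_div_mul_eq_div]
  exact congrArg (fun t => √t / (m : ℝ)) (congrFun hs p)

theorem isTotallyGeodesic_or_of_isFBiharmonicSubmanifold [ConnectedSpace M] (hm : 2 ≤ m)
    (hφ : IsIsometricImmersion g h φ) (hN : IsEinstein h lam) (hM : IsTotallyUmbilical g h φ)
    (hf : IsFBiharmonicSubmanifold g h φ) :
    IsTotallyGeodesic g h φ ∨
      IsBiharmonic g h φ ∧ 0 ≤ lam ∧ HasConstantMeanCurvature g h φ (√(lam / m)) := by
  obtain ⟨s, hs⟩ := exists_tensionSq_eq_const hm hφ hN hM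
  obtain ⟨p⟩ := (inferInstance : Nonempty M)
  have hs_nonneg : 0 ≤ s := (congrFun hs p).symm ▸ inner_self_nonneg (φ p) (tension g h φ p)
  rcases eq_or_ne s 0 with rfl | hs0
  · exact Or.inl (isTotallyGeodesic_of_tensionSq_eq_zero hφ hM hs)
  have hlam : lam = s / m := hf.eq_of_tensionSq_eq_const (by omega) hφ hN hM hs hs0
  have hH : √s / m = √(lam / m) := by
    rw [hlam, div_div, ← sq, Real.sqrt_div hs_nonneg, Real.sqrt_sq m.cast_nonneg]
  exact Or.inr ⟨isBiharmonic_of_tensionSq_eq hφ hN hM hs hs0 hlam,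
    hlam ▸ div_nonneg hs_nonneg m.cast_nonneg,
    hH ▸ hasConstantMeanCurvature_of_tensionSq_eq hφ hs hs0⟩

end Hypersurface

end FBiharmonic

end

open FBiharmonic in
theorem theorem3p6_general {m : ℕ} (hm : 2 ≤ m)
    {M : Type*} [TopologicalSpace M] [ConnectedSpace M]
    [ChartedSpace (EuclideanSpace ℝ (Fin m)) M] [IsManifold (𝓡 m) ∞ M]
    {N : Type*} [TopologicalSpace N]
    [ChartedSpace (EuclideanSpace ℝ (Fin (m + 1))) N] [IsManifold (𝓡 (m + 1)) ∞ N]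
    (g : FBiharmonic.Metric m M) (h : FBiharmonic.Metric (m + 1) N)
    (φ : M → N) (hφ : IsIsometricImmersion g h φ)
    (lam : ℝ) (hN : IsEinstein h lam) (hM : IsTotallyUmbilical g h φ) :
    IsFBiharmonicSubmanifold g h φ ↔
      IsTotallyGeodesic g h φ ∨
        (IsBiharmonic g h φ ∧ 0 ≤ lam ∧
          (HasConstantMeanCurvature g h φ (√(lam / m)) ∨
            HasConstantMeanCurvature g h φ (-√(lam / m)))) := by
  constructor
  · intro hf
    exact (isTotallyGeodesic_or_of_isFBiharmonicSubmanifold hm hφ hN hM hf).imp_right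
      fun ⟨hb, hlam, hH⟩ => ⟨hb, hlam, Or.inl hH⟩
  · rintro (hg | ⟨hb, -, -⟩)
    · exact (hg.isBiharmonic hφ hN).isFBiharmonicSubmanifold hφ.1
    · exact hb.isFBiharmonicSubmanifold hφ.1

open FBiharmonic in
theorem theorem3p6 {m : ℕ} (hm : 2 ≤ m)
    {M : Type*} [TopologicalSpace M] [T2Space M] [SecondCountableTopology M] [ConnectedSpace M]
    [ChartedSpace (EuclideanSpace ℝ (Fin m)) M] [IsManifold (𝓡 m) ∞ M]
    {N : Type*} [TopologicalSpace N] [T2Space N] [SecondCountableTopology N]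
    [ChartedSpace (EuclideanSpace ℝ (Fin (m + 1))) N] [IsManifold (𝓡 (m + 1)) ∞ N]
    (g : FBiharmonic.Metric m M) (h : FBiharmonic.Metric (m + 1) N)
    (φ : M → N) (hφ : IsIsometricImmersion g h φ)
    (lam : ℝ) (hN : IsEinstein h lam) (hM : IsTotallyUmbilical g h φ) :
    IsFBiharmonicSubmanifold g h φ ↔
      IsTotallyGeodesic g h φ ∨
        (IsBiharmonic g h φ ∧ 0 ≤ lam ∧
          (HasConstantMeanCurvature g h φ (√(lam / m)) ∨
            HasConstantMeanCurvature g h φ (-√(lam / m)))) :=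
  theorem3p6_general hm g h φ hφ lam hN hM
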